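/- Theorem 4.4 (Cartan.symm.action). Let $x^i$ ($i=1,\dots,n$) be independent variables, $u^\alpha$ ($\alpha=1,\dots,m$) dependent variables, and let $U$ be an open domain in the jet space $\mathrm J=(x^i,u^\alpha,u^\alpha_j,\dots)$ (product topology). A differential function on $U$ is a smooth function of finitely many of the jet coordinates, non-singular on $U$; $D_i=\partial_{x^i}+u^\alpha_{iI}\partial_{u^\alpha_I}$ and $D_I$ are the total derivatives. Let $G^A$ ($A=1,\dots,M$) be differential functions on $U$ and let $\mathcal E\subset U$ be the common zero set of all $D_IG^A$. Write $f'(P)=f_{u^\alpha_I}D_IP^\alpha$ for the Frechet derivative and, for a linear differential operator $R=(R^{I}_{ab}D_I)$, write $R^*(H)_b=(-1)^{|I|}D_I(R^I_{ab}H_a)$ for its adjoint. A symmetry is a tuple $P=(P^\alpha)$ of differential functions with $G'(P)^A|_{\mathcal E}=0$; an adjoint-symmetry is a tuple $Q=(Q_A)$ of differential functions with $G'^*(Q)_\alpha|_{\mathcal E}=0$. Let $R_P$, $R_Q$ denote linear differential operators in total derivatives, with differential functions on $U$ as coefficients, such that $G'(P)=R_P(G)$ and $G'^*(Q)=R_Q(G)$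 on $U$. Put $\mathrm{pr}\mathbf X_P=(D_IP^\alpha)\partial_{u^\alpha_I}$ and $\varpi_Q=Q_A\,\mathrm dG^A$, where $\mathrm d$ is the evolutionary differential ($\mathrm df=f_{u^\alpha_I}\mathrm du^\alpha_I$, $\mathrm dx^i=0$). The Lie derivative $\mathcal L_{\mathbf X_P}$ is the derivation acting on differential functions as $\mathrm{pr}\mathbf X_P$ and commuting with $\mathrm d$. For evolutionary 1-forms, $\omega_1|_{\mathcal E}=\omega_2|_{\mathcal E}$ (mod total $D$) means that all components of $\omega_1-\omega_2-D_i\theta^i$ vanish on $\mathcal E$ for some evolutionary 1-forms $\theta^i$, where $D_i(f\,\mathrm du^\alpha_I)=(D_if)\,\mathrm du^\alpha_I+f\,\mathrm du^\alpha_{iI}$. Let $$S_P(Q)=Q'(P)+R_P^*(Q),\qquad S_{1P}(Q)=R_P^*(Q)-R_Q^*(P),\qquad S_{2P}(Q)=Q'(P)+R_Q^*(P).$$ (a) If the system is regular, i.e. a differential function $f$ vanishes on $\mathcal E$ iff $f=R_f(G)$ for some linear differential operator $R_f$, then operators $R_P$, $R_Q$ exist for all symmetries $P$ and adjoint-symmetries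 $Q$, and they can be chosen to depend linearly on $P$ and $Q$ respectively. (b) For every symmetry $P$, every adjoint-symmetry $Q$ and every choice of $R_P$, $R_Q$: - Cartan's formula $\mathcal L_{\mathbf X_P}\varpi_Q=\mathrm d(\mathrm{pr}\mathbf X_P\rfloor\varpi_Q)+\mathrm{pr}\mathbf X_P\rfloor(\mathrm d\varpi_Q)$ holds. - Lie derivative: $\mathcal L_{\mathbf X_P}\varpi_Q|_{\mathcal E}=\varpi_{S_P(Q)}|_{\mathcal E}=0$ (mod total $D$), and $S_P(Q)$ is an adjoint-symmetry. - Differential term: $\mathrm d(\mathrm{pr}\mathbf X_P\rfloor\varpi_Q)|_{\mathcal E}$ equals (mod total $D$) both $\varpi_{R_P^*(Q)}|_{\mathcal E}$ and $\varpi_{R_Q^*(P)}|_{\mathcal E}$; hence $\varpi_{S_{1P}(Q)}|_{\mathcal E}=0$ (mod total $D$), and $S_{1P}(Q)$ is an adjoint-symmetry. - Hook term: $(\mathrm{pr}\mathbf X_P\rfloor\mathrm d\varpi_Q)|_{\mathcal E}$ equals (mod total $D$) both $\varpi_{Q'(P)}|_{\mathcal E}$ and $-\varpi_{R_Q^*(P)}|_{\mathcal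 E}$; hence $\varpi_{S_{2P}(Q)}|_{\mathcal E}=0$ (mod total $D$), and $S_{2P}(Q)$ is an adjoint-symmetry. - $S_{1P}(Q)+S_{2P}(Q)=S_P(Q)$. (c) For every choice of $R_P$ and $R_Q$ depending linearly on $P$ and $Q$, the maps $(P,Q)\mapsto S_P(Q)$, $S_{1P}(Q)$, $S_{2P}(Q)$ are bilinear maps from symmetries and adjoint-symmetries to adjoint-symmetries, and $S_1+S_2=S$. -/

import Mathlib

noncomputable section

namespace JetCalculus

/-! ## Jet space -/

/-- Unordered multi-indices `I`; `I i` is the number of differentiations in the direction `x^i`. -/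
abbrev MultiIdx (n : ℕ) : Type := Fin n → ℕ

/-- The order `|I|`. -/
def MultiIdx.order {n : ℕ} (I : MultiIdx n) : ℕ := ∑ i, I i

/-- Labels `(α, I)` of the derivative variables `u^α_I` (including `u^α` itself). -/
abbrev Var (n m : ℕ) : Type := Fin m × MultiIdx n

/-- The label of `u^α_{Ii}`, given that of `u^α_I`. -/
def Var.next {n m : ℕ} (i : Fin n) (v : Var n m) : Var n m := (v.1, v.2 + Pi.single i 1)

/-- Labels of all the coordinates `x^i`, `u^α_I`. -/
abbrev Coord (n m : ℕ) : Type := Fin n ⊕ Var n m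

/-- Jet space `J = (x^i, u^α, u^α_j, …)`, with the product topology. -/
abbrev Jet (n m : ℕ) : Type := Coord n m → ℝ

open TopologicalSpace (Opens)

variable {n m : ℕ}

/-! ## Differential functions -/

variable {U : Opens (Jet n m)}

section DifferentialFunctions

open scoped ContDiff

/-- `f` is a smooth function of finitely many jet coordinates on `U`. -/
def IsDiffFun (U : Opens (Jet n m)) (f : U → ℝ) : Prop :=
  ∃ (S : Finset (Coord n m)) (W : Set (S → ℝ)) (g : (S → ℝ) → ℝ),
    IsOpen W ∧ ContDiffOn ℝ ∞ g W ∧ ∀ z : U, S.restrict z.1 ∈ W ∧ f z = g (S.restrict z.1)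

lemma IsDiffFun.binary {U : Opens (Jet n m)} {f₁ f₂ : U → ℝ} (h₁ : IsDiffFun U f₁)
    (h₂ : IsDiffFun U f₂) {k : ℝ × ℝ → ℝ} (hk : ContDiff ℝ ∞ k) :
    IsDiffFun U (fun z => k (f₁ z, f₂ z)) := by
  classical
  obtain ⟨S₁, W₁, g₁, hW₁, hg₁, hf₁⟩ := h₁
  obtain ⟨S₂, W₂, g₂, hW₂, hg₂, hf₂⟩ := h₂
  have s₁ : S₁ ⊆ S₁ ∪ S₂ := Finset.subset_union_left
  have s₂ : S₂ ⊆ S₁ ∪ S₂ := Finset.subset_union_right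
  have c₁ : ContDiff ℝ ∞ (Finset.restrict₂ (π := fun _ => ℝ) s₁) :=
    contDiff_pi.2 fun i => contDiff_apply ℝ ℝ _
  have c₂ : ContDiff ℝ ∞ (Finset.restrict₂ (π := fun _ => ℝ) s₂) :=
    contDiff_pi.2 fun i => contDiff_apply ℝ ℝ _
  refine ⟨S₁ ∪ S₂, Finset.restrict₂ (π := fun _ => ℝ) s₁ ⁻¹' W₁ ∩
    Finset.restrict₂ (π := fun _ => ℝ) s₂ ⁻¹' W₂,
    fun y => k (g₁ (Finset.restrict₂ (π := fun _ => ℝ) s₁ y),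
      g₂ (Finset.restrict₂ (π := fun _ => ℝ) s₂ y)),
    (hW₁.preimage c₁.continuous).inter (hW₂.preimage c₂.continuous), ?_, fun z => ?_⟩
  · exact hk.comp_contDiffOn
      ((hg₁.comp c₁.contDiffOn fun y hy => hy.1).prodMk (hg₂.comp c₂.contDiffOn fun y hy => hy.2))
  · exact ⟨⟨(hf₁ z).1, (hf₂ z).1⟩, by
      change k (f₁ z, f₂ z) = _
      rw [(hf₁ z).2, (hf₂ z).2]; rfl⟩

/-- The algebra of differential functions on the open domain `U` of jet space. -/
def diffFunAlgebra (U : Opens (Jet n m)) : Subalgebra ℝ (U → ℝ) where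
  carrier := {f | IsDiffFun U f}
  mul_mem' h₁ h₂ := IsDiffFun.binary h₁ h₂ (k := fun p => p.1 * p.2) (contDiff_fst.mul contDiff_snd)
  add_mem' h₁ h₂ := IsDiffFun.binary h₁ h₂ (k := fun p => p.1 + p.2) (contDiff_fst.add contDiff_snd)
  algebraMap_mem' r :=
    ⟨∅, Set.univ, fun _ => r, isOpen_univ, contDiffOn_const, fun _ => ⟨trivial, rfl⟩⟩

/-- Differential functions `f(x, u^{(k)})`, of any finite order `k`, non-singular on `U`. -/
def DiffFun (U : Opens (Jet n m)) : Type := diffFunAlgebra U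

instance (U : Opens (Jet n m)) : CommRing (DiffFun U) :=
  inferInstanceAs (CommRing (diffFunAlgebra U))

instance (U : Opens (Jet n m)) : Algebra ℝ (DiffFun U) :=
  inferInstanceAs (Algebra ℝ (diffFunAlgebra U))

/-- The value of a differential function at a point of `U`, as an algebra homomorphism. -/
def evalAt {U : Opens (Jet n m)} (z : U) : DiffFun U →ₐ[ℝ] ℝ :=
  (Pi.evalAlgHom ℝ (fun _ : U => ℝ) z).comp (diffFunAlgebra U).val

lemma DiffFun.ext {U : Opens (Jet n m)} {f g : DiffFun U}
    (h : ∀ z, evalAt z f = evalAt z g) : f = g :=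
  Subtype.ext (funext h)

/-- The coordinate `c` as a differential function. -/
def coordFun (U : Opens (Jet n m)) (c : Coord n m) : DiffFun U :=
  ⟨fun z => z.1 c, {c}, Set.univ, fun y => y ⟨c, Finset.mem_singleton_self c⟩, isOpen_univ,
    (contDiff_apply ℝ ℝ _).contDiffOn, fun _ => ⟨trivial, rfl⟩⟩

/-- The partial derivative with respect to the coordinate `c` of a function on `U`
(the value of the extension outside of `U` is irrelevant since `U` is open). -/
def pderivFun (c : Coord n m) (f : U → ℝ) (z : U) : ℝ :=
  deriv (fun t => Function.extend (Subtype.val : U → Jet n m) f 0 (Function.update z.1 c t)) (z.1 c)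

lemma hasDerivAt_of_rep (c : Coord n m) {f : U → ℝ} {S : Finset (Coord n m)} {W : Set (S → ℝ)}
    {g : (S → ℝ) → ℝ} (hW : IsOpen W) (hg : ContDiffOn ℝ ∞ g W)
    (hf : ∀ z : U, S.restrict z.1 ∈ W ∧ f z = g (S.restrict z.1)) (z : U) :
    HasDerivAt (fun t => Function.extend (Subtype.val : U → Jet n m) f 0 (Function.update z.1 c t))
      (fderiv ℝ g (S.restrict z.1) (S.restrict (π := fun _ => ℝ) (Pi.single c 1))) (z.1 c) := by
  have hz : Function.update z.1 c (z.1 c) = z.1 := Function.update_eq_self _ _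
  have hcont : Continuous fun t : ℝ => Function.update z.1 c t :=
    continuous_const.update c continuous_id
  have hmem : ∀ᶠ t in nhds (z.1 c), Function.update z.1 c t ∈ U := by
    refine hcont.continuousAt.eventually_mem (U.isOpen.mem_nhds ?_)
    rw [hz]; exact z.2
  have heq : (fun t => Function.extend (Subtype.val : U → Jet n m) f 0 (Function.update z.1 c t)) =ᶠ[nhds (z.1 c)]
      fun t => g (S.restrict (Function.update z.1 c t)) := by
    filter_upwards [hmem] with t ht
    exact (Subtype.val_injective.extend_apply f 0 ⟨_, ht⟩).trans (hf ⟨_, ht⟩).2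
  refine HasDerivAt.congr_of_eventuallyEq ?_ heq
  have h1 : HasDerivAt (fun t => S.restrict (Function.update z.1 c t))
      (S.restrict (π := fun _ => ℝ) (Pi.single c 1)) (z.1 c) := by
    rw [hasDerivAt_pi]
    intro s
    by_cases hs : s.1 = c
    · subst hs
      simp only [Finset.restrict, Function.update_self, Pi.single_eq_same]
      exact hasDerivAt_id (z.1 s.1)
    · simpa [Finset.restrict, Function.update_of_ne hs, Pi.single_eq_of_ne hs] using
        hasDerivAt_const (z.1 c) (z.1 s.1)
  have h2 : HasFDerivAt g (fderiv ℝ g (S.restrict z.1))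
      (S.restrict (Function.update z.1 c (z.1 c))) := by
    rw [hz]
    exact ((hg.differentiableOn (by simp)).differentiableAt
      (hW.mem_nhds (hf z).1)).hasFDerivAt
  exact h2.comp_hasDerivAt (z.1 c) h1

lemma pderivFun_of_rep (c : Coord n m) {f : U → ℝ} {S : Finset (Coord n m)} {W : Set (S → ℝ)}
    {g : (S → ℝ) → ℝ} (hW : IsOpen W) (hg : ContDiffOn ℝ ∞ g W)
    (hf : ∀ z : U, S.restrict z.1 ∈ W ∧ f z = g (S.restrict z.1)) (z : U) :
    pderivFun c f z = fderiv ℝ g (S.restrict z.1) (S.restrict (π := fun _ => ℝ) (Pi.single c 1)) :=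
  (hasDerivAt_of_rep c hW hg hf z).deriv

lemma IsDiffFun.pderivFun {f : U → ℝ} (hf : IsDiffFun U f) (c : Coord n m) :
    IsDiffFun U (pderivFun c f) := by
  obtain ⟨S, W, g, hW, hg, h⟩ := hf
  refine ⟨S, W, fun y => fderiv ℝ g y (S.restrict (π := fun _ => ℝ) (Pi.single c 1)), hW, ?_, fun z =>
    ⟨(h z).1, pderivFun_of_rep c hW hg h z⟩⟩
  exact (hg.fderiv_of_isOpen hW (by simp)).clm_apply contDiffOn_const

lemma IsDiffFun.differentiableAt {f : U → ℝ} (hf : IsDiffFun U f) (c : Coord n m) (z : U) :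
    DifferentiableAt ℝ (fun t => Function.extend (Subtype.val : U → Jet n m) f 0 (Function.update z.1 c t))
      (z.1 c) := by
  obtain ⟨S, W, g, hW, hg, h⟩ := hf
  exact (hasDerivAt_of_rep c hW hg h z).differentiableAt

end DifferentialFunctions

lemma extend_add (f₁ f₂ : U → ℝ) (w : Jet n m) :
    Function.extend (Subtype.val : U → Jet n m) (f₁ + f₂) 0 w =
      Function.extend (Subtype.val : U → Jet n m) f₁ 0 w + Function.extend (Subtype.val : U → Jet n m) f₂ 0 w := by
  by_cases hw : w ∈ U
  · have e (f : U → ℝ) : Function.extend (Subtype.val : U → Jet n m) f 0 w = f ⟨w, hw⟩ :=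
      Subtype.val_injective.extend_apply f 0 ⟨w, hw⟩
    simp [e]
  · have e (f : U → ℝ) : Function.extend (Subtype.val : U → Jet n m) f 0 w = 0 :=
      Function.extend_apply' (f := (Subtype.val : U → Jet n m)) f 0 w (by rintro ⟨a, ha⟩; exact hw (ha ▸ a.2))
    simp [e]

lemma extend_smul (r : ℝ) (f : U → ℝ) (w : Jet n m) :
    Function.extend (Subtype.val : U → Jet n m) (r • f) 0 w = r * Function.extend (Subtype.val : U → Jet n m) f 0 w := by
  by_cases hw : w ∈ U
  · have e (f : U → ℝ) : Function.extend (Subtype.val : U → Jet n m) f 0 w = f ⟨w, hw⟩ :=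
      Subtype.val_injective.extend_apply f 0 ⟨w, hw⟩
    simp [e]
  · have e (f : U → ℝ) : Function.extend (Subtype.val : U → Jet n m) f 0 w = 0 :=
      Function.extend_apply' (f := (Subtype.val : U → Jet n m)) f 0 w (by rintro ⟨a, ha⟩; exact hw (ha ▸ a.2))
    simp [e]

/-- The partial derivative `∂_{x^i}` or `∂_{u^α_I}` of differential functions. -/
def pderiv (c : Coord n m) : DiffFun U →ₗ[ℝ] DiffFun U where
  toFun f := ⟨pderivFun c f.1, IsDiffFun.pderivFun f.2 c⟩
  map_add' f₁ f₂ := DiffFun.ext fun z => by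
    change pderivFun c (f₁.1 + f₂.1) z = pderivFun c f₁.1 z + pderivFun c f₂.1 z
    simp only [pderivFun, extend_add]
    exact deriv_fun_add (IsDiffFun.differentiableAt f₁.2 c z) (IsDiffFun.differentiableAt f₂.2 c z)
  map_smul' r f := DiffFun.ext fun z => by
    change pderivFun c (r • f.1) z = r * pderivFun c f.1 z
    simp only [pderivFun, extend_smul]
    exact deriv_const_mul _ (IsDiffFun.differentiableAt f.2 c z)

lemma finite_pderiv_ne_zero (f : DiffFun U) : {v : Var n m | pderiv (Sum.inr v) f ≠ 0}.Finite := by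
  obtain ⟨S, W, g, hW, hg, h⟩ := f.2
  refine (S.finite_toSet.preimage Sum.inr_injective.injOn).subset fun v hv => ?_
  by_contra hvS
  refine hv (Subtype.ext (funext fun z => ?_))
  have h0 : S.restrict (π := fun _ => ℝ) (Pi.single (Sum.inr v) 1) = 0 := by
    funext s
    have : s.1 ≠ Sum.inr v := fun hs => hvS (by
      change Sum.inr v ∈ S
      exact hs ▸ s.2)
    simp [Finset.restrict, Pi.single_eq_of_ne this]
  change pderivFun (Sum.inr v) f.1 z = 0
  rw [pderivFun_of_rep _ hW hg h z, h0, map_zero]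

/-! ## Evolutionary forms and vector fields -/

/-- Evolutionary 1-forms `∑ Q_α^I du^α_I` (finite sums), given by their components. -/
abbrev OneForm (U : Opens (Jet n m)) : Type := Var n m →₀ DiffFun U

/-- Evolutionary vector fields `∑ P^α_I ∂_{u^α_I}` (possibly with infinitely many components). -/
abbrev EvolField (U : Opens (Jet n m)) : Type := Var n m → DiffFun U

/-- The evolutionary differential `df = ∑ f_{u^α_I} du^α_I` of a differential function
(`dx^i = 0`). -/
def extD : DiffFun U →ₗ[ℝ] OneForm U where
  toFun f := Finsupp.ofSupportFinite (fun v => pderiv (Sum.inr v) f) (finite_pderiv_ne_zero f)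
  map_add' f₁ f₂ := by ext v : 1; exact map_add (pderiv (Sum.inr v)) f₁ f₂
  map_smul' r f := by ext v : 1; exact map_smul (pderiv (Sum.inr v)) r f

/-- The total derivative `D_i f = ∂_{x^i} f + ∑ u^α_{Ii} ∂_{u^α_I} f`. -/
def totalD (i : Fin n) : DiffFun U →ₗ[ℝ] DiffFun U :=
  pderiv (Sum.inl i) +
    Finsupp.lsum ℝ (fun v => LinearMap.mulLeft ℝ (coordFun U (Sum.inr (v.next i)))) ∘ₗ extD

/-- The higher total derivative `D_I`. -/
def totalDMulti (I : MultiIdx n) : Module.End ℝ (DiffFun U) :=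
  ((List.finRange n).map fun i => (totalD i : Module.End ℝ (DiffFun U)) ^ I i).prod

/-- The total derivative of an evolutionary 1-form:
`D_i (f du^α_I) = (D_i f) du^α_I + f du^α_{Ii}`. -/
def totalDForm (i : Fin n) (ω : OneForm U) : OneForm U :=
  ω.sum fun v f => Finsupp.single v (totalD i f) + Finsupp.single (v.next i) f

/-- The hook `X ⌋ ω` of an evolutionary vector field and a 1-form. -/
def hook (X : EvolField U) (ω : OneForm U) : DiffFun U := ω.sum fun v f => X v * f

/-- Evolutionary 2-forms `½ ∑ Ω_{vw} du_v ∧ du_w`, given by their antisymmetric components. -/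
def TwoForm (U : Opens (Jet n m)) : Submodule (DiffFun U) (Var n m × Var n m →₀ DiffFun U) where
  carrier := {Ω | ∀ v w, Ω (v, w) = -Ω (w, v)}
  zero_mem' v w := by simp
  add_mem' h₁ h₂ v w := by
    simp only [Finsupp.add_apply, h₁ v w, h₂ v w]; ring
  smul_mem' r Ω h v w := by
    simp only [Finsupp.smul_apply, smul_eq_mul, h v w]; ring

/-- The tensor product of 1-forms. -/
def tensor (ω₁ ω₂ : OneForm U) : Var n m × Var n m →₀ DiffFun U :=
  ω₁.sum fun v f => ω₂.sum fun w g => Finsupp.single (v, w) (f * g)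

lemma tensor_apply (ω₁ ω₂ : OneForm U) (v w : Var n m) :
    tensor ω₁ ω₂ (v, w) = ω₁ v * ω₂ w := by
  classical
  simp only [tensor, Finsupp.sum, Finsupp.finsetSum_apply, Finsupp.single_apply, Prod.mk.injEq]
  rw [Finset.sum_eq_single v, Finset.sum_eq_single w]
  · simp
  · intro b _ hb; simp [hb]
  · intro h; simp [Finsupp.notMem_support_iff.1 h]
  · intro b _ hb; simp [hb]
  · intro h; simp [Finsupp.notMem_support_iff.1 h]

/-- The wedge product of 1-forms, `ω₁ ∧ ω₂ = ω₁ ⊗ ω₂ - ω₂ ⊗ ω₁`. -/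
def wedge (ω₁ ω₂ : OneForm U) : TwoForm U :=
  ⟨tensor ω₁ ω₂ - tensor ω₂ ω₁, fun v w => by
    simp only [Finsupp.sub_apply, tensor_apply]; ring⟩

/-- The evolutionary differential of a 1-form, `d(∑ Q_α^I du^α_I) = ∑ dQ_α^I ∧ du^α_I`. -/
def extDForm (ω : OneForm U) : TwoForm U :=
  ω.sum fun v f => wedge (extD f) (Finsupp.single v 1)

/-- The hook `X ⌋ Ω` of an evolutionary vector field and a 2-form,
with components `(X ⌋ Ω)_w = ∑_v X_v Ω_{vw}`. -/
def hookTwo (X : EvolField U) (Ω : TwoForm U) : OneForm U :=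
  Ω.1.sum fun p f => Finsupp.single p.2 (X p.1 * f)

/-- The Lie derivative of a 1-form along an evolutionary vector field `X`: the derivation that
acts on differential functions as `X` and on differentials as `𝓛_X du_v = d(X_v)`, that is
`𝓛_X (∑ f_v du_v) = ∑ (X f_v) du_v + f_v d(X_v)`. -/
def lieDeriv (X : EvolField U) (ω : OneForm U) : OneForm U :=
  ω.sum fun v f => Finsupp.single v (hook X (extD f)) + f • extD (X v)

/-- The prolongation `pr X_P = ∑ (D_I P^α) ∂_{u^α_I}` of `X_P = P^α ∂_{u^α}`. -/
def prolong (P : Fin m → DiffFun U) : EvolField U := fun v => totalDMulti v.2 (P v.1)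

/-! ## Linear differential operators -/

/-- Matrix linear differential operators `R_{ab} = ∑_I R_{ab}^I D_I` in total derivatives. -/
abbrev DiffOp (U : Opens (Jet n m)) (a b : Type) : Type := a → b → (MultiIdx n →₀ DiffFun U)

/-- `R(F)_a = ∑_{b, I} R_{ab}^I D_I F_b`. -/
def DiffOp.apply {a b : Type} [Fintype b] (R : DiffOp U a b) (F : b → DiffFun U) :
    a → DiffFun U :=
  fun i => ∑ j, (R i j).sum fun I r => r * totalDMulti I (F j)

/-- The formal adjoint: `R^*(H)_b = ∑_{a, I} (-1)^{|I|} D_I (R_{ab}^I H_a)`. -/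
def DiffOp.adjoint {a b : Type} [Fintype a] (R : DiffOp U a b) (H : a → DiffFun U) :
    b → DiffFun U :=
  fun j => ∑ i, (R i j).sum fun I r => (-1) ^ MultiIdx.order I * totalDMulti I (r * H i)

/-- The Frechet derivative `f'`, with `(f')_{aα} = ∑_I (f_a)_{u^α_I} D_I`. -/
def frechet {a : Type} (f : a → DiffFun U) : DiffOp U a (Fin m) :=
  fun i α => (extD (f i)).curry α

lemma DiffOp.apply_add {a b : Type} [Fintype b] (R : DiffOp U a b) (F₁ F₂ : b → DiffFun U) :
    R.apply (F₁ + F₂) = R.apply F₁ + R.apply F₂ := by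
  funext i
  simp [DiffOp.apply, mul_add, Finsupp.sum, Finset.sum_add_distrib]

lemma DiffOp.apply_smul {a b : Type} [Fintype b] (R : DiffOp U a b) (c : ℝ)
    (F : b → DiffFun U) : R.apply (c • F) = c • R.apply F := by
  funext i
  simp [DiffOp.apply, Finsupp.sum, Finset.smul_sum]

lemma DiffOp.adjoint_add {a b : Type} [Fintype a] (R : DiffOp U a b) (F₁ F₂ : a → DiffFun U) :
    R.adjoint (F₁ + F₂) = R.adjoint F₁ + R.adjoint F₂ := by
  funext i
  simp [DiffOp.adjoint, mul_add, Finsupp.sum, Finset.sum_add_distrib]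

lemma DiffOp.adjoint_smul {a b : Type} [Fintype a] (R : DiffOp U a b) (c : ℝ)
    (F : a → DiffFun U) : R.adjoint (c • F) = c • R.adjoint F := by
  funext i
  simp [DiffOp.adjoint, Finsupp.sum, Finset.smul_sum]

/-! ## PDE systems, symmetries and adjoint-symmetries -/

variable {M : ℕ}

/-- The solution space `𝓔` in jet space: the zero set of all `D_I G^A`. -/
def solutionSpace (G : Fin M → DiffFun U) : Set U :=
  {z | ∀ (A : Fin M) (I : MultiIdx n), evalAt z (totalDMulti I (G A)) = 0}

/-- `f|_𝓔 = 0`. -/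
def VanishesOn (G : Fin M → DiffFun U) (f : DiffFun U) : Prop :=
  ∀ z ∈ solutionSpace G, evalAt z f = 0

/-- Regularity of a PDE system: a differential function vanishes on `𝓔` iff it is
`R_f(G)` for a linear differential operator `R_f`. -/
def IsRegularSystem (G : Fin M → DiffFun U) : Prop :=
  ∀ f : DiffFun U, VanishesOn G f ↔
    ∃ R : DiffOp U Unit (Fin M), f = R.apply G ()

/-- Symmetries (in characteristic form): `G'(P)|_𝓔 = 0`. -/
def symmetries (G : Fin M → DiffFun U) : Submodule ℝ (Fin m → DiffFun U) where
  carrier := {P | ∀ A, VanishesOn G ((frechet G).apply P A)}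
  zero_mem' A z _ := by simp [DiffOp.apply]
  add_mem' h₁ h₂ A z hz := by simp [DiffOp.apply_add, h₁ A z hz, h₂ A z hz]
  smul_mem' c P h A z hz := by simp [DiffOp.apply_smul, h A z hz]

/-- Adjoint-symmetries: `G'^*(Q)|_𝓔 = 0`. -/
def adjointSymmetries (G : Fin M → DiffFun U) : Submodule ℝ (Fin M → DiffFun U) where
  carrier := {Q | ∀ α, VanishesOn G ((frechet G).adjoint Q α)}
  zero_mem' A z _ := by simp [DiffOp.adjoint]
  add_mem' h₁ h₂ A z hz := by simp [DiffOp.adjoint_add, h₁ A z hz, h₂ A z hz]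
  smul_mem' c P h A z hz := by simp [DiffOp.adjoint_smul, h A z hz]

/-- The 1-form `ϖ_Q = Q_A dG^A`. -/
def varpi (G Q : Fin M → DiffFun U) : OneForm U := ∑ A, Q A • extD (G A)

/-- `ω₁|_𝓔 = ω₂|_𝓔` modulo total derivatives: on `𝓔`, `ω₁ - ω₂` agrees with `∑_i D_i θ^i`
for some evolutionary 1-forms `θ^i`. -/
def EqOnModD (G : Fin M → DiffFun U) (ω₁ ω₂ : OneForm U) : Prop :=
  ∃ θ : Fin n → OneForm U, ∀ v, VanishesOn G ((ω₁ - ω₂ - ∑ i, totalDForm i (θ i)) v)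

/-- `R_P` satisfies `G'(P) = R_P(G)`. -/
def IsSymmetryOperator (G : Fin M → DiffFun U) (P : Fin m → DiffFun U) (R : DiffOp U (Fin M) (Fin M)) :
    Prop := (frechet G).apply P = R.apply G

/-- `R_Q` satisfies `G'^*(Q) = R_Q(G)`. -/
def IsAdjointSymmetryOperator (G Q : Fin M → DiffFun U) (R : DiffOp U (Fin m) (Fin M)) :
    Prop := (frechet G).adjoint Q = R.apply G

/-- `S_P(Q) = Q'(P) + R_P^*(Q)`. -/
def actionLie (P : Fin m → DiffFun U) (Q : Fin M → DiffFun U)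
    (RP : DiffOp U (Fin M) (Fin M)) : Fin M → DiffFun U :=
  (frechet Q).apply P + RP.adjoint Q

/-- `S_{1 P}(Q) = R_P^*(Q) - R_Q^*(P)`. -/
def actionDiff (P : Fin m → DiffFun U) (Q : Fin M → DiffFun U)
    (RP : DiffOp U (Fin M) (Fin M)) (RQ : DiffOp U (Fin m) (Fin M)) : Fin M → DiffFun U :=
  RP.adjoint Q - RQ.adjoint P

/-- `S_{2 P}(Q) = Q'(P) + R_Q^*(P)`. -/
def actionHook (P : Fin m → DiffFun U) (Q : Fin M → DiffFun U)
    (RQ : DiffOp U (Fin m) (Fin M)) : Fin M → DiffFun U :=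
  (frechet Q).apply P + RQ.adjoint P

end JetCalculus

end

open JetCalculus

noncomputable section

namespace JetCalculus

open TopologicalSpace (Opens)

variable {n m M : ℕ} {U : Opens (Jet n m)}

/-! ## Partial derivatives -/

/-! The argument replaces restriction to the solution space by algebra. The ideal `diffIdeal G`
generated by all `D_I G^A` is stable under total derivatives, its elements vanish on the solution
space, and it contains every `R(G)`. A 1-form is called null when its Euler operator has components
in this ideal. Total derivatives `D_i θ^i` and forms with components in the ideal are null, and
integration by parts (`sub_sourceForm_euler_mem`) shows that every null form is a sum of two such
forms.

Null forms give both kinds of conclusion: a null difference is an equality on the solution space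
modulo total derivatives (`eqOnModD_of_sub_mem`), and since `ϖ_Q` has Euler operator `G'^*(Q)`, a
null `ϖ_Q` makes `Q` an adjoint-symmetry. Part (b) thus becomes a list of congruences modulo null
forms, starting from Cartan's formula, which is an exact identity.

The Lie derivative is `ϖ_{Q'(P)} + Q_A d(R_P(G)^A)`, and integration by parts turns the last sum
into `ϖ_{R_P^*(Q)}`. It is also null: `ϖ_Q` is a total derivative plus a source form with
coefficients `R_Q(G)`, and the Lie derivative along `pr X_P` commutes with `D_i` while `pr X_P`
preserves the ideal.

The function `pr X_P ⌋ ϖ_Q` equals `Q · R_P(G)`, and also `P · R_Q(G)` up to total derivatives; `d(H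
· R(G)) ≡ ϖ_{R^*(H)}` then evaluates the differential term in two ways. The hook term follows by
subtraction in Cartan's formula.

For regular systems, linear choices of the operators come from splitting the linear map `R ↦ R(G)`
over its range. -/

lemma extend_mul (f₁ f₂ : U → ℝ) (w : Jet n m) :
    Function.extend (Subtype.val : U → Jet n m) (f₁ * f₂) 0 w =
      Function.extend (Subtype.val : U → Jet n m) f₁ 0 w *
        Function.extend (Subtype.val : U → Jet n m) f₂ 0 w := by
  by_cases hw : w ∈ U
  · have e (f : U → ℝ) : Function.extend (Subtype.val : U → Jet n m) f 0 w = f ⟨w, hw⟩ :=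
      Subtype.val_injective.extend_apply f 0 ⟨w, hw⟩
    simp [e]
  · have e (f : U → ℝ) : Function.extend (Subtype.val : U → Jet n m) f 0 w = 0 :=
      Function.extend_apply' (f := (Subtype.val : U → Jet n m)) f 0 w
        (by rintro ⟨a, ha⟩; exact hw (ha ▸ a.2))
    simp [e]

lemma extend_update_self (f : U → ℝ) (c : Coord n m) (z : U) :
    Function.extend (Subtype.val : U → Jet n m) f 0 (Function.update z.1 c (z.1 c)) = f z := by
  rw [Function.update_eq_self]
  exact Subtype.val_injective.extend_apply f 0 z

lemma pderiv_mul (c : Coord n m) (f g : DiffFun U) :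
    pderiv c (f * g) = f * pderiv c g + g * pderiv c f := by
  refine DiffFun.ext fun z => ?_
  change pderivFun c (f.1 * g.1) z = f.1 z * pderivFun c g.1 z + g.1 z * pderivFun c f.1 z
  simp only [pderivFun, extend_mul]
  refine (deriv_fun_mul (IsDiffFun.differentiableAt f.2 c z)
    (IsDiffFun.differentiableAt g.2 c z)).trans ?_
  simp only [extend_update_self]
  ring

lemma pderiv_coordFun (c c' : Coord n m) :
    pderiv c (coordFun U c') = if c' = c then 1 else 0 := by
  refine DiffFun.ext fun z => ?_
  have h := pderivFun_of_rep (U := U) (f := (coordFun U c').1) c (S := {c'})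
    (g := fun y => y ⟨c', Finset.mem_singleton_self c'⟩) isOpen_univ
    (contDiff_apply ℝ ℝ _).contDiffOn (fun _ => ⟨trivial, rfl⟩) z
  change pderivFun c (coordFun U c').1 z = _
  have hd : fderiv ℝ (fun y : ({c'} : Finset (Coord n m)) → ℝ =>
      y ⟨c', Finset.mem_singleton_self c'⟩) (({c'} : Finset (Coord n m)).restrict z.1) =
      ContinuousLinearMap.proj ⟨c', Finset.mem_singleton_self c'⟩ :=
    (ContinuousLinearMap.proj (R := ℝ) (φ := fun _ : ({c'} : Finset (Coord n m)) => ℝ)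
      ⟨c', Finset.mem_singleton_self c'⟩).fderiv
  rw [h, hd]
  split_ifs with hc
  · simp [Finset.restrict, hc]
  · simp [Finset.restrict, hc]

lemma pderiv_comm (c c' : Coord n m) (f : DiffFun U) :
    pderiv c (pderiv c' f) = pderiv c' (pderiv c f) := by
  obtain ⟨S, W, g, hW, hg, h⟩ := f.2
  -- Both iterated partial derivatives are values of the second derivative of one finite-dimensional
  -- representative `g`, so its symmetry suffices.
  have key (a b : Coord n m) (z : U) : pderivFun a (pderivFun b f.1) z =
      fderiv ℝ (fderiv ℝ g) (S.restrict z.1) (S.restrict (π := fun _ => ℝ) (Pi.single a 1))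
        (S.restrict (π := fun _ => ℝ) (Pi.single b 1)) := by
    have hd := hg.fderiv_of_isOpen (m := (⊤ : ℕ∞)) hW (by simp)
    rw [pderivFun_of_rep a (g := fun y => fderiv ℝ g y (S.restrict (π := fun _ => ℝ) (Pi.single b 1)))
      hW (hd.clm_apply contDiffOn_const) (fun z => ⟨(h z).1, pderivFun_of_rep b hW hg h z⟩)]
    have : DifferentiableAt ℝ (fderiv ℝ g) (S.restrict z.1) :=
      (hd.differentiableOn (by simp)).differentiableAt (hW.mem_nhds (h z).1)
    rw [fderiv_clm_apply this (differentiableAt_const _)]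
    simp
  refine DiffFun.ext fun z => ?_
  change pderivFun c (pderivFun c' f.1) z = pderivFun c' (pderivFun c f.1) z
  rw [key, key]
  exact ((hg.contDiffAt (hW.mem_nhds (h z).1)).isSymmSndFDerivAt (by
    simpa using WithTop.coe_le_coe.2 (le_top (a := (2 : ℕ∞))))).eq _ _

@[simp] lemma extD_apply (f : DiffFun U) (v : Var n m) : extD f v = pderiv (Sum.inr v) f := rfl

lemma extD_mul (f g : DiffFun U) : extD (f * g) = f • extD g + g • extD f := by
  ext v : 1
  simp [pderiv_mul]

/-! ## Hooks and total derivatives -/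

@[simp] lemma hook_zero (X : EvolField U) : hook X 0 = 0 := by simp [hook]

@[simp] lemma hook_single (X : EvolField U) (v : Var n m) (f : DiffFun U) :
    hook X (Finsupp.single v f) = X v * f := by simp [hook]

lemma hook_add (X : EvolField U) (ω₁ ω₂ : OneForm U) :
    hook X (ω₁ + ω₂) = hook X ω₁ + hook X ω₂ := by
  simp only [hook]
  exact Finsupp.sum_add_index' (by simp) (by intros; ring)

lemma hook_smul (X : EvolField U) (f : DiffFun U) (ω : OneForm U) :
    hook X (f • ω) = f * hook X ω := by
  induction ω using Finsupp.induction_linear with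
  | zero => simp
  | add ω₁ ω₂ h₁ h₂ => simp only [smul_add, hook_add, h₁, h₂, mul_add]
  | single v g => simp only [Finsupp.smul_single, smul_eq_mul, hook_single]; ring

lemma hook_sum (X : EvolField U) {ι : Type*} (s : Finset ι) (ω : ι → OneForm U) :
    hook X (∑ a ∈ s, ω a) = ∑ a ∈ s, hook X (ω a) :=
  map_sum (AddMonoidHom.mk' (hook X) (hook_add X)) ω s

/-- The derivation of differential functions given by an evolutionary vector field. -/
lemma hook_extD_mul (X : EvolField U) (f g : DiffFun U) :
    hook X (extD (f * g)) = f * hook X (extD g) + g * hook X (extD f) := by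
  rw [extD_mul, hook_add, hook_smul, hook_smul]

lemma hook_extD_eq_sum (X : EvolField U) (f : DiffFun U) {S : Finset (Var n m)}
    (hS : (extD f).support ⊆ S) :
    hook X (extD f) = ∑ v ∈ S, X v * pderiv (Sum.inr v) f :=
  Finsupp.sum_of_support_subset _ hS _ (by simp)

/-- Since partial derivatives commute, differentiating introduces no new variables. Sums for `f` and
for its derivatives can therefore share one finite index set. -/
lemma support_extD_pderiv_subset (c : Coord n m) (f : DiffFun U) :
    (extD (pderiv c f)).support ⊆ (extD f).support := by
  intro v hv
  rw [Finsupp.mem_support_iff, extD_apply] at hv ⊢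
  intro h
  rw [pderiv_comm, h, map_zero] at hv
  exact hv rfl

/-- Leibniz rule and equality of mixed partials. The correction term, in which the coefficients of
`X` are differentiated, is what makes `d` commute with both `D_i` and the Lie derivative. -/
lemma pderiv_hook_extD (X : EvolField U) (f : DiffFun U) (c : Coord n m) :
    pderiv c (hook X (extD f)) =
      hook X (extD (pderiv c f)) + hook (fun v => pderiv c (X v)) (extD f) := by
  rw [hook_extD_eq_sum X f subset_rfl,
    hook_extD_eq_sum X _ (support_extD_pderiv_subset c f), hook_extD_eq_sum _ f subset_rfl,
    map_sum, ← Finset.sum_add_distrib]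
  refine Finset.sum_congr rfl fun v _ => ?_
  rw [pderiv_mul, pderiv_comm c]
  ring

lemma totalD_eq (i : Fin n) (f : DiffFun U) :
    totalD i f = pderiv (Sum.inl i) f +
      hook (fun v => coordFun U (Sum.inr (v.next i))) (extD f) := by
  simp [totalD, hook]
  rfl

lemma totalD_mul (i : Fin n) (f g : DiffFun U) :
    totalD i (f * g) = f * totalD i g + g * totalD i f := by
  rw [totalD_eq, totalD_eq, totalD_eq, pderiv_mul, hook_extD_mul]
  ring

lemma totalD_eq_sum (i : Fin n) (f : DiffFun U) {S : Finset (Var n m)}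
    (hS : (extD f).support ⊆ S) :
    totalD i f = pderiv (Sum.inl i) f +
      ∑ v ∈ S, coordFun U (Sum.inr (v.next i)) * pderiv (Sum.inr v) f := by
  rw [totalD_eq, hook_extD_eq_sum _ _ hS]

@[simp] lemma totalDForm_zero (i : Fin n) : totalDForm i (0 : OneForm U) = 0 := by
  simp [totalDForm]

lemma totalDForm_single (i : Fin n) (v : Var n m) (f : DiffFun U) :
    totalDForm i (Finsupp.single v f) =
      Finsupp.single v (totalD i f) + Finsupp.single (v.next i) f := by
  simp [totalDForm]

lemma totalDForm_add (i : Fin n) (ω₁ ω₂ : OneForm U) :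
    totalDForm i (ω₁ + ω₂) = totalDForm i ω₁ + totalDForm i ω₂ := by
  simp only [totalDForm]
  refine Finsupp.sum_add_index' (by simp) ?_
  intro v f g
  simp only [map_add, Finsupp.single_add]
  abel

lemma totalDForm_smul (i : Fin n) (f : DiffFun U) (ω : OneForm U) :
    totalDForm i (f • ω) = f • totalDForm i ω + totalD i f • ω := by
  induction ω using Finsupp.induction_linear with
  | zero => simp
  | add ω₁ ω₂ h₁ h₂ => simp only [smul_add, totalDForm_add, h₁, h₂]; abel
  | single v g =>
    simp only [Finsupp.smul_single, smul_eq_mul, totalDForm_single, totalD_mul, smul_add,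
      Finsupp.single_add, mul_comm g]
    abel

/-- The hook with an indicator field extracts the component of `ω` at the predecessor of `w` in
direction `i`, and gives zero when there is none. -/
lemma totalDForm_apply (i : Fin n) (ω : OneForm U) (w : Var n m) :
    totalDForm i ω w = totalD i (ω w) + hook (fun v => if v.next i = w then 1 else 0) ω := by
  classical
  induction ω using Finsupp.induction_linear with
  | zero => simp
  | add ω₁ ω₂ h₁ h₂ =>
    simp only [totalDForm_add, hook_add, Finsupp.add_apply, h₁, h₂, map_add]
    ring
  | single v g =>
    rw [totalDForm_single, hook_single, Finsupp.add_apply, Finsupp.single_apply,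
      Finsupp.single_apply, Finsupp.single_apply, apply_ite (totalD i), map_zero]
    split_ifs <;> simp

/-- The coefficients of `D_i` are coordinates `u_{vi}`, so their partial derivatives are exactly the
indicators that appear in the components of `D_i(df)`. -/
lemma extD_totalD (i : Fin n) (f : DiffFun U) :
    extD (totalD i f) = totalDForm i (extD f) := by
  ext w : 1
  rw [totalDForm_apply, extD_apply, extD_apply, totalD_eq, totalD_eq, map_add, pderiv_hook_extD,
    pderiv_comm, add_assoc]
  simp only [pderiv_coordFun, Sum.inr.injEq]

lemma hook_totalDForm (X : EvolField U) (i : Fin n) (ω : OneForm U) {S : Finset (Var n m)}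
    (hS : ω.support ⊆ S) :
    hook X (totalDForm i ω) = ∑ v ∈ S, (X v * totalD i (ω v) + X (v.next i) * ω v) := by
  have h : hook X (totalDForm i ω) = ω.sum fun v f => X v * totalD i f + X (v.next i) * f := by
    clear hS
    induction ω using Finsupp.induction_linear with
    | zero => simp
    | add ω₁ ω₂ h₁ h₂ =>
      rw [totalDForm_add, hook_add, h₁, h₂, Finsupp.sum_add_index' (by simp)]
      intro v f g
      rw [map_add]; ring
    | single v g => simp [totalDForm_single, hook_add]
  rw [h]
  exact Finsupp.sum_of_support_subset _ hS _ (by simp)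

lemma totalD_comm (i j : Fin n) (f : DiffFun U) :
    totalD i (totalD j f) = totalD j (totalD i f) := by
  -- Full expansion of `D_j D_i f`. Each of the four groups of terms is symmetric in `i` and `j`;
  -- the last one arises when `D_j` hits a coefficient `u_{vi}`.
  have key (i j : Fin n) : totalD j (totalD i f) =
      pderiv (Sum.inl j) (pderiv (Sum.inl i) f) +
      ∑ v ∈ (extD f).support,
        (coordFun U (Sum.inr (v.next i)) * pderiv (Sum.inl j) (pderiv (Sum.inr v) f) +
        coordFun U (Sum.inr (v.next j)) * pderiv (Sum.inl i) (pderiv (Sum.inr v) f)) +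
      ∑ v ∈ (extD f).support, ∑ w ∈ (extD f).support, coordFun U (Sum.inr (v.next j)) *
        coordFun U (Sum.inr (w.next i)) * pderiv (Sum.inr w) (pderiv (Sum.inr v) f) +
      ∑ v ∈ (extD f).support,
        coordFun U (Sum.inr ((v.next i).next j)) * pderiv (Sum.inr v) f := by
    rw [totalD_eq j, extD_totalD, hook_totalDForm _ _ _ subset_rfl, totalD_eq i, map_add,
      pderiv_hook_extD, hook_extD_eq_sum _ _ (support_extD_pderiv_subset _ f),
      hook_extD_eq_sum _ f subset_rfl]
    simp only [pderiv_coordFun, reduceCtorEq, if_false, zero_mul, Finset.sum_const_zero, add_zero,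
      Finset.sum_add_distrib, extD_apply,
      totalD_eq_sum i _ (support_extD_pderiv_subset (Sum.inr _) f), mul_add, Finset.mul_sum,
      mul_assoc, pderiv_comm (Sum.inr _) (Sum.inl _)]
    ring
  rw [key, key, pderiv_comm]
  congr 1
  · congr 1
    · congr 1
      exact Finset.sum_congr rfl fun v _ => add_comm _ _
    · rw [Finset.sum_comm]
      refine Finset.sum_congr rfl fun v _ => Finset.sum_congr rfl fun w _ => ?_
      rw [pderiv_comm]; ring
  · refine Finset.sum_congr rfl fun v _ => ?_
    simp only [Var.next, add_right_comm]

/-! ## Higher total derivatives -/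

@[simp] lemma totalDMulti_zero : totalDMulti (0 : MultiIdx n) = (1 : Module.End ℝ (DiffFun U)) := by
  simp [totalDMulti]

lemma totalDMulti_add_single (I : MultiIdx n) (i : Fin n) :
    (totalDMulti (I + Pi.single i 1) : Module.End ℝ (DiffFun U)) =
      (totalD i : Module.End ℝ (DiffFun U)) * totalDMulti I := by
  -- `D_I` is an ordered product over the directions. The extra factor `D_i` is moved to the front
  -- past the others by commutativity, and `Nodup` ensures that it appears only once.
  have key (l : List (Fin n)) (hl : l.Nodup) :
      (l.map fun j => (totalD j : Module.End ℝ (DiffFun U)) ^ (I + Pi.single i 1 : MultiIdx n) j).prod =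
        (if i ∈ l then (totalD i : Module.End ℝ (DiffFun U)) else 1) *
          (l.map fun j => (totalD j : Module.End ℝ (DiffFun U)) ^ I j).prod := by
    induction l with
    | nil => simp
    | cons j l ih =>
      rw [List.nodup_cons] at hl
      rw [List.map_cons, List.prod_cons, ih hl.2, List.map_cons, List.prod_cons]
      by_cases hij : i = j
      · subst hij
        simp [hl.1, pow_succ', mul_assoc]
      · have hc : Commute ((totalD j : Module.End ℝ (DiffFun U)) ^ I j)
            (if i ∈ l then (totalD i : Module.End ℝ (DiffFun U)) else 1) := by
          split_ifs
          · exact (show Commute (totalD j : Module.End ℝ (DiffFun U)) (totalD i) from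
              LinearMap.ext fun f => totalD_comm j i f).pow_left _
          · exact Commute.one_right _
        simp only [List.mem_cons, hij, false_or, Pi.add_apply, Pi.single_apply,
          if_neg (Ne.symm hij), add_zero]
        rw [← mul_assoc, hc.eq, mul_assoc]
  have h := key _ (List.nodup_finRange n)
  rwa [if_pos (List.mem_finRange i)] at h

lemma totalDMulti_next (I : MultiIdx n) (i : Fin n) (f : DiffFun U) :
    totalDMulti (I + Pi.single i 1) f = totalD i (totalDMulti I f) := by
  rw [totalDMulti_add_single]; rfl

lemma MultiIdx.order_add_single (I : MultiIdx n) (i : Fin n) :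
    MultiIdx.order (I + Pi.single i 1) = MultiIdx.order I + 1 := by
  simp [MultiIdx.order, Finset.sum_add_distrib]

lemma MultiIdx.induction {p : MultiIdx n → Prop} (zero : p 0)
    (add_single : ∀ I i, p I → p (I + Pi.single i 1)) (I : MultiIdx n) : p I := by
  induction h : MultiIdx.order I generalizing I with
  | zero =>
    have : I = 0 := by
      funext i
      simpa using (Finset.sum_eq_zero_iff.1 h) i (Finset.mem_univ i)
    exact this ▸ zero
  | succ k ih =>
    obtain ⟨i, hi⟩ : ∃ i, I i ≠ 0 := by
      by_contra! hI
      simp [MultiIdx.order, hI] at h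
    have hI : I = (I - Pi.single i 1) + Pi.single i 1 := by
      funext j
      by_cases hj : j = i
      · subst hj
        simp; omega
      · simp [hj]
    rw [hI]
    refine add_single _ _ (ih _ ?_)
    rw [hI, MultiIdx.order_add_single] at h
    omega

lemma totalDMulti_totalD (I : MultiIdx n) (i : Fin n) (f : DiffFun U) :
    totalDMulti I (totalD i f) = totalD i (totalDMulti I f) := by
  induction I using MultiIdx.induction with
  | zero => simp
  | add_single I j ih => rw [totalDMulti_next, ih, totalD_comm, totalDMulti_next]

/-! ## Cartan calculus of evolutionary forms -/

@[simp] lemma lieDeriv_zero (X : EvolField U) : lieDeriv X 0 = 0 := by simp [lieDeriv]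

@[simp] lemma extD_zero : extD (0 : DiffFun U) = 0 := map_zero _

lemma lieDeriv_single (X : EvolField U) (v : Var n m) (f : DiffFun U) :
    lieDeriv X (Finsupp.single v f) = Finsupp.single v (hook X (extD f)) + f • extD (X v) := by
  simp [lieDeriv]

lemma lieDeriv_add (X : EvolField U) (ω₁ ω₂ : OneForm U) :
    lieDeriv X (ω₁ + ω₂) = lieDeriv X ω₁ + lieDeriv X ω₂ := by
  simp only [lieDeriv]
  refine Finsupp.sum_add_index' (by simp) ?_
  intro v f g
  simp only [map_add, hook_add, Finsupp.single_add, add_smul]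
  abel

lemma lieDeriv_sum (X : EvolField U) {ι : Type*} (s : Finset ι) (ω : ι → OneForm U) :
    lieDeriv X (∑ a ∈ s, ω a) = ∑ a ∈ s, lieDeriv X (ω a) :=
  map_sum (AddMonoidHom.mk' (lieDeriv X) (lieDeriv_add X)) ω s

lemma lieDeriv_smul (X : EvolField U) (f : DiffFun U) (ω : OneForm U) :
    lieDeriv X (f • ω) = hook X (extD f) • ω + f • lieDeriv X ω := by
  induction ω using Finsupp.induction_linear with
  | zero => simp
  | add ω₁ ω₂ h₁ h₂ => simp only [smul_add, lieDeriv_add, h₁, h₂]; abel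
  | single v g =>
    simp only [Finsupp.smul_single, smul_eq_mul, lieDeriv_single, hook_extD_mul,
      Finsupp.single_add, smul_add, mul_comm g, smul_smul]
    abel

lemma lieDeriv_apply (X : EvolField U) (ω : OneForm U) (w : Var n m) :
    lieDeriv X ω w = hook X (extD (ω w)) + hook (fun v => pderiv (Sum.inr w) (X v)) ω := by
  classical
  induction ω using Finsupp.induction_linear with
  | zero => simp
  | add ω₁ ω₂ h₁ h₂ =>
    simp only [lieDeriv_add, hook_add, Finsupp.add_apply, h₁, h₂, map_add]
    ring
  | single v g =>
    rw [lieDeriv_single, hook_single, Finsupp.add_apply, Finsupp.single_apply,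
      Finsupp.single_apply]
    split_ifs <;> simp [mul_comm]

/-- The Lie derivative commutes with `d`. -/
lemma lieDeriv_extD (X : EvolField U) (f : DiffFun U) :
    lieDeriv X (extD f) = extD (hook X (extD f)) := by
  ext w : 1
  rw [lieDeriv_apply, extD_apply, extD_apply, pderiv_hook_extD]

lemma wedge_val (ω₁ ω₂ : OneForm U) :
    (wedge ω₁ ω₂).1 = tensor ω₁ ω₂ - tensor ω₂ ω₁ := rfl

lemma extDForm_add (ω₁ ω₂ : OneForm U) :
    extDForm (ω₁ + ω₂) = extDForm ω₁ + extDForm ω₂ := by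
  have h (f g : DiffFun U) (v : Var n m) : wedge (extD (f + g)) (Finsupp.single v 1) =
      wedge (extD f) (Finsupp.single v 1) + wedge (extD g) (Finsupp.single v 1) := by
    refine Subtype.ext (Finsupp.ext fun ⟨a, b⟩ => ?_)
    simp only [Submodule.coe_add, wedge_val, Finsupp.sub_apply, Finsupp.add_apply, tensor_apply,
      map_add]
    ring
  simp only [extDForm]
  refine Finsupp.sum_add_index' (fun v => ?_) fun v f g => h f g v
  simpa using h 0 0 v

lemma hookTwo_add (X : EvolField U) (Ω₁ Ω₂ : TwoForm U) :
    hookTwo X (Ω₁ + Ω₂) = hookTwo X Ω₁ + hookTwo X Ω₂ := by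
  simp only [hookTwo, Submodule.coe_add]
  exact Finsupp.sum_add_index' (by simp) (by intros; simp [mul_add])

/-- The hook of `X` with the first factor of an arbitrary 2-tensor. -/
def hookTensor (X : EvolField U) (Ω : Var n m × Var n m →₀ DiffFun U) : OneForm U :=
  Ω.sum fun p f => Finsupp.single p.2 (X p.1 * f)

lemma hookTensor_add (X : EvolField U) (Ω₁ Ω₂ : Var n m × Var n m →₀ DiffFun U) :
    hookTensor X (Ω₁ + Ω₂) = hookTensor X Ω₁ + hookTensor X Ω₂ :=
  Finsupp.sum_add_index' (by simp) (by intros; simp [mul_add])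

lemma tensor_add_left (ω₁ ω₂ η : OneForm U) :
    tensor (ω₁ + ω₂) η = tensor ω₁ η + tensor ω₂ η := by
  ext ⟨a, b⟩ : 1
  simp only [Finsupp.add_apply, tensor_apply, add_mul]

lemma tensor_add_right (η ω₁ ω₂ : OneForm U) :
    tensor η (ω₁ + ω₂) = tensor η ω₁ + tensor η ω₂ := by
  ext ⟨a, b⟩ : 1
  simp only [Finsupp.add_apply, tensor_apply, mul_add]

lemma hookTensor_tensor (X : EvolField U) (ω η : OneForm U) :
    hookTensor X (tensor ω η) = hook X ω • η := by
  induction ω using Finsupp.induction_linear with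
  | zero => simp [tensor, hookTensor]
  | add ω₁ ω₂ h₁ h₂ => rw [tensor_add_left, hookTensor_add, h₁, h₂, hook_add, add_smul]
  | single v f =>
    induction η using Finsupp.induction_linear with
    | zero => simp [tensor, hookTensor]
    | add ω₁ ω₂ h₁ h₂ => rw [tensor_add_right, hookTensor_add, h₁, h₂, smul_add]
    | single w g => simp [tensor, hookTensor, mul_assoc, -Finsupp.single_mul]

/-- The two summands of the wedge are not antisymmetric separately, so the computation passes
through `hookTensor` on arbitrary tensors. -/
lemma hookTwo_wedge (X : EvolField U) (ω η : OneForm U) :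
    hookTwo X (wedge ω η) = hook X ω • η - hook X η • ω := by
  have h : hookTensor X (tensor ω η) =
      hookTensor X (tensor ω η - tensor η ω) + hookTensor X (tensor η ω) := by
    rw [← hookTensor_add, sub_add_cancel]
  rw [hookTensor_tensor, hookTensor_tensor] at h
  rw [h, add_sub_cancel_right]
  rfl

lemma extDForm_single (v : Var n m) (f : DiffFun U) :
    extDForm (Finsupp.single v f) = wedge (extD f) (Finsupp.single v 1) := by
  refine Finsupp.sum_single_index (Subtype.ext (Finsupp.ext fun ⟨a, b⟩ => ?_))
  simp [wedge_val, tensor_apply]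

/-- Cartan's formula. -/
lemma lieDeriv_eq (X : EvolField U) (ω : OneForm U) :
    lieDeriv X ω = extD (hook X ω) + hookTwo X (extDForm ω) := by
  induction ω using Finsupp.induction_linear with
  | zero => simp [extDForm, hookTwo]
  | add ω₁ ω₂ h₁ h₂ =>
    rw [lieDeriv_add, hook_add, extDForm_add, hookTwo_add, h₁, h₂, map_add]
    abel
  | single v f =>
    -- On `f du_v`, the hook of `df ∧ du_v` is `X(f) du_v - X_v df`, and `d(X_v f)` supplies `X_v df
    -- + f dX_v`; the terms `X_v df` cancel.
    rw [lieDeriv_single, extDForm_single, hookTwo_wedge, hook_single, hook_single, extD_mul,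
      Finsupp.smul_single, smul_eq_mul, mul_one, mul_one]
    abel

/-! ## Prolonged fields commute with total derivatives -/

lemma prolong_next (P : Fin m → DiffFun U) (i : Fin n) (v : Var n m) :
    prolong P (v.next i) = totalD i (prolong P v) :=
  totalDMulti_next _ _ _

/-- The coefficients of a prolongation satisfy `X_{vi} = D_i X_v`, so hooking `D_i(f du_v)`
reproduces the Leibniz rule for `D_i(X_v f)`. -/
lemma hook_prolong_totalDForm (P : Fin m → DiffFun U) (i : Fin n) (ω : OneForm U) :
    hook (prolong P) (totalDForm i ω) = totalD i (hook (prolong P) ω) := by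
  induction ω using Finsupp.induction_linear with
  | zero => simp
  | add ω₁ ω₂ h₁ h₂ => rw [totalDForm_add, hook_add, h₁, h₂, hook_add, map_add]
  | single v f =>
    rw [totalDForm_single, hook_add, hook_single, hook_single, hook_single, totalD_mul,
      prolong_next, mul_comm f]

lemma hook_prolong_extD_totalD (P : Fin m → DiffFun U) (i : Fin n) (f : DiffFun U) :
    hook (prolong P) (extD (totalD i f)) = totalD i (hook (prolong P) (extD f)) := by
  rw [extD_totalD, hook_prolong_totalDForm]

lemma hook_prolong_extD_totalDMulti (P : Fin m → DiffFun U) (I : MultiIdx n) (f : DiffFun U) :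
    hook (prolong P) (extD (totalDMulti I f)) = totalDMulti I (hook (prolong P) (extD f)) := by
  induction I using MultiIdx.induction with
  | zero => simp
  | add_single I i ih => rw [totalDMulti_next, hook_prolong_extD_totalD, ih, totalDMulti_next]

lemma lieDeriv_totalDForm (P : Fin m → DiffFun U) (i : Fin n) (ω : OneForm U) :
    lieDeriv (prolong P) (totalDForm i ω) = totalDForm i (lieDeriv (prolong P) ω) := by
  induction ω using Finsupp.induction_linear with
  | zero => simp
  | add ω₁ ω₂ h₁ h₂ => rw [totalDForm_add, lieDeriv_add, h₁, h₂, lieDeriv_add, totalDForm_add]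
  | single v f =>
    simp only [totalDForm_single, lieDeriv_add, lieDeriv_single, totalDForm_add, totalDForm_smul,
      hook_prolong_totalDForm, prolong_next, extD_totalD]
    abel

/-! ## Integration by parts -/

/-- Iterated integration by parts, modulo an additive subgroup `K` that contains the
total derivatives `f w_{Ii} + (D_i f) w_I` of `f w_I`. -/
lemma smul_sub_smul_mem_of_parts {V : Type*} [AddCommGroup V] [Module (DiffFun U) V]
    (K : AddSubgroup V) (w : MultiIdx n → V)
    (h : ∀ (f : DiffFun U) I i, f • w (I + Pi.single i 1) + totalD i f • w I ∈ K)
    (I : MultiIdx n) (f : DiffFun U) :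
    f • w I - ((-1) ^ MultiIdx.order I * totalDMulti I f) • w 0 ∈ K := by
  induction I using MultiIdx.induction generalizing f with
  | zero => simp [MultiIdx.order]
  | add_single I i ih =>
    -- One integration by parts trades `f w_{Ii}` for `-(D_i f) w_I`; the induction hypothesis is
    -- then applied to `D_i f`, hence the generalization over `f`.
    have := K.sub_mem (h f I i) (ih (totalD i f))
    rw [totalDMulti_totalD] at this
    rw [totalDMulti_next, MultiIdx.order_add_single, pow_succ, mul_neg_one, neg_mul, neg_smul]
    convert this using 1
    abel

/-- The Euler operator of an evolutionary 1-form, `E(f du^α_I)_α = (-1)^{|I|} D_I f`. -/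
def euler : OneForm U →ₗ[ℝ] (Fin m → DiffFun U) :=
  Finsupp.lsum ℝ fun v => LinearMap.single ℝ (fun _ => DiffFun U) v.1 ∘ₗ
    LinearMap.mulLeft ℝ ((-1) ^ MultiIdx.order v.2) ∘ₗ totalDMulti v.2

lemma euler_single (v : Var n m) (f : DiffFun U) :
    euler (Finsupp.single v f) =
      Pi.single v.1 ((-1) ^ MultiIdx.order v.2 * totalDMulti v.2 f) := by
  simp [euler]

/-- The two terms of `D_i(f du_v)` both contribute `D_i D_I f` up to sign, and the signs are
opposite because the orders differ by one. -/
lemma euler_totalDForm (i : Fin n) (ω : OneForm U) : euler (totalDForm i ω) = 0 := by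
  induction ω using Finsupp.induction_linear with
  | zero => simp
  | add ω₁ ω₂ h₁ h₂ => rw [totalDForm_add, map_add, h₁, h₂, add_zero]
  | single v f =>
    rw [totalDForm_single, map_add, euler_single, euler_single, Var.next, totalDMulti_next,
      totalDMulti_totalD, MultiIdx.order_add_single, ← Pi.single_add, pow_succ]
    simp

/-- Source forms `∑_α h_α du^α`. -/
def sourceForm (h : Fin m → DiffFun U) : OneForm U := ∑ α, h α • Finsupp.single (α, 0) 1

lemma sourceForm_add (h₁ h₂ : Fin m → DiffFun U) :
    sourceForm (h₁ + h₂) = sourceForm h₁ + sourceForm h₂ := by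
  simp [sourceForm, Finset.sum_add_distrib]

lemma sourceForm_apply (h : Fin m → DiffFun U) (v : Var n m) :
    sourceForm h v = if v.2 = 0 then h v.1 else 0 := by
  classical
  obtain ⟨α, I⟩ := v
  simp only [sourceForm, Finsupp.finsetSum_apply, Finsupp.smul_apply, Finsupp.single_apply,
    Prod.mk.injEq, smul_eq_mul, mul_ite, mul_one, mul_zero]
  split_ifs with hI
  · simp [hI]
  · simp [Ne.symm hI]

/-- The 1-forms `∑_i D_i θ^i`. -/
def totalForms (U : Opens (Jet n m)) : AddSubgroup (OneForm U) where
  carrier := {ω | ∃ θ : Fin n → OneForm U, ω = ∑ i, totalDForm i (θ i)}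
  zero_mem' := ⟨0, by simp⟩
  add_mem' := by
    rintro _ _ ⟨θ₁, rfl⟩ ⟨θ₂, rfl⟩
    exact ⟨θ₁ + θ₂, by simp [totalDForm_add, Finset.sum_add_distrib]⟩
  neg_mem' := by
    rintro _ ⟨θ, rfl⟩
    refine ⟨-θ, ?_⟩
    rw [← Finset.sum_neg_distrib]
    refine Finset.sum_congr rfl fun i _ => ?_
    exact (map_neg (AddMonoidHom.mk' (totalDForm i) (totalDForm_add i)) (θ i)).symm

lemma totalDForm_mem_totalForms (i : Fin n) (ω : OneForm U) :
    totalDForm i ω ∈ totalForms U := by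
  classical
  refine ⟨Pi.single i ω, ?_⟩
  rw [Finset.sum_eq_single i (fun j _ hj => by simp [hj]) (by simp)]
  simp

lemma euler_of_mem_totalForms {ω : OneForm U} (h : ω ∈ totalForms U) : euler ω = 0 := by
  obtain ⟨θ, rfl⟩ := h
  simp [map_sum, euler_totalDForm]

/-- Every 1-form is equivalent to a source form modulo total derivatives. -/
lemma sub_sourceForm_euler_mem (ω : OneForm U) : ω - sourceForm (euler ω) ∈ totalForms U := by
  classical
  induction ω using Finsupp.induction_linear with
  | zero => simp [sourceForm]
  | add ω₁ ω₂ h₁ h₂ =>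
    rw [map_add, sourceForm_add, add_sub_add_comm]
    exact (totalForms U).add_mem h₁ h₂
  | single v f =>
    have := smul_sub_smul_mem_of_parts (totalForms U)
      (fun I => Finsupp.single ((v.1, I) : Var n m) (1 : DiffFun U)) (fun g I i => by
        have h := totalDForm_mem_totalForms i (Finsupp.single ((v.1, I) : Var n m) g)
        rw [totalDForm_single] at h
        simpa [Var.next, add_comm] using h) v.2 f
    convert this using 2
    · simp
    · rw [euler_single, sourceForm, Finset.sum_eq_single v.1 (fun j _ hj => by simp [hj])
        (by simp)]
      simp

/-! ## The differential ideal of a system -/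

/-- The ideal generated by all `D_I G^A`. -/
def diffIdeal (G : Fin M → DiffFun U) : Ideal (DiffFun U) :=
  Ideal.span (Set.range fun p : Fin M × MultiIdx n => totalDMulti p.2 (G p.1))

variable {G : Fin M → DiffFun U}

lemma totalDMulti_mem_diffIdeal (A : Fin M) (I : MultiIdx n) :
    totalDMulti I (G A) ∈ diffIdeal G :=
  Ideal.subset_span ⟨(A, I), rfl⟩

lemma vanishesOn_of_mem_diffIdeal {f : DiffFun U} (hf : f ∈ diffIdeal G) : VanishesOn G f := by
  intro z hz
  induction hf using Submodule.span_induction with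
  | mem f hf => obtain ⟨p, rfl⟩ := hf; exact hz p.1 p.2
  | zero => exact map_zero _
  | add f g _ _ h₁ h₂ => rw [map_add, h₁, h₂, add_zero]
  | smul r f _ h => rw [smul_eq_mul, map_mul, h, mul_zero]

/-- By Leibniz, a derivation preserves an ideal as soon as it sends the generators into it. This is
used for both `D_i` and `pr X_P`. -/
lemma mem_diffIdeal_of_derivation {δ : DiffFun U → DiffFun U}
    (add : ∀ f g, δ (f + g) = δ f + δ g) (mul : ∀ f g, δ (f * g) = f * δ g + g * δ f)
    (h : ∀ A I, δ (totalDMulti I (G A)) ∈ diffIdeal G) {f : DiffFun U}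
    (hf : f ∈ diffIdeal G) : δ f ∈ diffIdeal G := by
  induction hf using Submodule.span_induction with
  | mem f hf => obtain ⟨p, rfl⟩ := hf; exact h p.1 p.2
  | zero => 
    have h0 : δ 0 = 0 := map_zero (AddMonoidHom.mk' δ add)
    rw [h0]
    exact Ideal.zero_mem _
  | add f g _ _ h₁ h₂ => rw [add]; exact Ideal.add_mem _ h₁ h₂
  | smul r f hf h =>
    rw [smul_eq_mul, mul]
    exact Ideal.add_mem _ (Ideal.mul_mem_left _ _ h) (Ideal.mul_mem_right _ _ hf)

lemma totalD_mem_diffIdeal (i : Fin n) {f : DiffFun U} (hf : f ∈ diffIdeal G) :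
    totalD i f ∈ diffIdeal G :=
  mem_diffIdeal_of_derivation (map_add _) (totalD_mul i) (fun A I => by
    rw [← totalDMulti_next]; exact totalDMulti_mem_diffIdeal _ _) hf

lemma totalDMulti_mem_diffIdeal_of_mem (I : MultiIdx n) {f : DiffFun U} (hf : f ∈ diffIdeal G) :
    totalDMulti I f ∈ diffIdeal G := by
  induction I using MultiIdx.induction with
  | zero => simpa using hf
  | add_single I i ih => rw [totalDMulti_next]; exact totalD_mem_diffIdeal i ih

lemma DiffOp.apply_mem_diffIdeal {a : Type} (R : DiffOp U a (Fin M)) (i : a) :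
    R.apply G i ∈ diffIdeal G :=
  Ideal.sum_mem _ fun _ _ => Ideal.sum_mem _ fun _ _ =>
    Ideal.mul_mem_left _ _ (totalDMulti_mem_diffIdeal _ _)

/-- The 1-forms with Euler operator in the differential ideal of the system. -/
def nullForms (G : Fin M → DiffFun U) : AddSubgroup (OneForm U) where
  carrier := {ω | ∀ α, euler ω α ∈ diffIdeal G}
  zero_mem' α := by simp
  add_mem' h₁ h₂ α := by rw [map_add]; exact Ideal.add_mem _ (h₁ α) (h₂ α)
  neg_mem' h α := by
    rw [map_neg]; exact (diffIdeal G).neg_mem (h α)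

lemma totalForms_le_nullForms : totalForms U ≤ nullForms G := fun ω h α => by
  rw [euler_of_mem_totalForms h]; exact Ideal.zero_mem _

/-- The Euler operator only applies signed total derivatives to components, and the ideal is stable
under these. -/
lemma mem_nullForms_of_forall_mem {ω : OneForm U} (h : ∀ v, ω v ∈ diffIdeal G) :
    ω ∈ nullForms G := by
  classical
  rw [← ω.sum_single]
  refine AddSubgroup.sum_mem _ fun v _ α => ?_
  rw [euler_single, Pi.single_apply]
  split_ifs
  · exact Ideal.mul_mem_left _ _ (totalDMulti_mem_diffIdeal_of_mem _ (h v))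
  · exact Ideal.zero_mem _

lemma smul_mem_nullForms {f : DiffFun U} (hf : f ∈ diffIdeal G) (ω : OneForm U) :
    f • ω ∈ nullForms G :=
  mem_nullForms_of_forall_mem fun _ => Ideal.mul_mem_right _ _ hf

/-- The forms `θ^i` are those produced by integrating the difference by parts. What remains is its
source form, whose coefficients lie in the ideal and so vanish on the solution space. -/
lemma eqOnModD_of_sub_mem {ω₁ ω₂ : OneForm U} (h : ω₁ - ω₂ ∈ nullForms G) :
    EqOnModD G ω₁ ω₂ := by
  obtain ⟨θ, hθ⟩ := sub_sourceForm_euler_mem (ω₁ - ω₂)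
  refine ⟨θ, fun v => ?_⟩
  rw [← hθ, sub_sub_cancel, sourceForm_apply]
  split_ifs
  · exact vanishesOn_of_mem_diffIdeal (h _)
  · exact vanishesOn_of_mem_diffIdeal (Ideal.zero_mem _)

/-! ## Frechet derivatives and adjoints -/

lemma sum_curry_sum (ω : OneForm U) (h : Fin m → MultiIdx n → DiffFun U →ₗ[ℝ] DiffFun U) :
    ∑ α, (ω.curry α).sum (fun I f => h α I f) = ω.sum fun v f => h v.1 v.2 f := by
  classical
  induction ω using Finsupp.induction_linear with
  | zero =>
    have hc (α : Fin m) : (0 : OneForm U).curry α = 0 := by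
      ext I : 1
      simp [Finsupp.curry_apply]
    simp [hc]
  | add ω₁ ω₂ h₁ h₂ =>
    rw [Finsupp.sum_add_index' (by simp) (by simp), ← h₁, ← h₂, ← Finset.sum_add_distrib]
    refine Finset.sum_congr rfl fun α _ => ?_
    have hc : (ω₁ + ω₂).curry α = ω₁.curry α + ω₂.curry α := by
      ext I : 1
      simp [Finsupp.curry_apply]
    rw [hc, Finsupp.sum_add_index' (by simp) (by simp)]
  | single v f =>
    rw [Finset.sum_eq_single v.1]
    · simp
    · intro α _ hα
      simp [hα]
    · simp

lemma curry_sum_eq (ω : OneForm U) (α : Fin m) (h : MultiIdx n → DiffFun U →ₗ[ℝ] DiffFun U) :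
    (ω.curry α).sum (fun I f => h I f) = ω.sum fun v f => if v.1 = α then h v.2 f else 0 := by
  classical
  -- A family supported at the index `α` isolates one row of the curried form.
  have := sum_curry_sum ω fun β I => if β = α then h I else 0
  rw [Finset.sum_eq_single α (fun β _ hβ => by simp [hβ, Finsupp.sum]) (by simp)] at this
  simp only [if_true] at this
  rw [this]
  refine Finset.sum_congr rfl fun v _ => ?_
  by_cases hv : v.1 = α <;> simp [hv]

/-- The Frechet derivative `f'(P)` is the derivative of `f` along `pr X_P`. -/
lemma frechet_apply {a : Type} (F : a → DiffFun U) (P : Fin m → DiffFun U) (i : a) :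
    (frechet F).apply P i = hook (prolong P) (extD (F i)) := by
  have := sum_curry_sum (extD (F i)) fun α I => LinearMap.mulRight ℝ (totalDMulti I (P α))
  refine this.trans (Finset.sum_congr rfl fun v _ => ?_)
  exact mul_comm _ _

lemma euler_smul_apply (q : DiffFun U) (ω : OneForm U) (α : Fin m) :
    euler (q • ω) α =
      (ω.curry α).sum fun I r => (-1) ^ MultiIdx.order I * totalDMulti I (r * q) := by
  classical
  have := curry_sum_eq ω α fun I => LinearMap.mulLeft ℝ ((-1) ^ MultiIdx.order I) ∘ₗ
    totalDMulti I ∘ₗ LinearMap.mulRight ℝ q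
  refine Eq.trans ?_ this.symm
  induction ω using Finsupp.induction_linear with
  | zero => simp
  | add ω₁ ω₂ h₁ h₂ =>
    rw [smul_add, map_add, Pi.add_apply, h₁ (curry_sum_eq _ _ _), h₂ (curry_sum_eq _ _ _),
      Finsupp.sum_add_index' (by simp)]
    intro v f g
    split_ifs <;> simp [add_mul, mul_add]
  | single v f =>
    rw [Finsupp.smul_single, euler_single, Pi.single_apply, Finsupp.sum_single_index (by simp)]
    simp [mul_comm, eq_comm]

/-- The Euler operator of `ϖ_Q` is `G'^*(Q)`. -/
lemma euler_varpi (G Q : Fin M → DiffFun U) : euler (varpi G Q) = (frechet G).adjoint Q := by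
  funext α
  simp only [varpi, map_sum, Finset.sum_apply, euler_smul_apply]
  rfl

lemma varpi_add (G Q₁ Q₂ : Fin M → DiffFun U) :
    varpi G (Q₁ + Q₂) = varpi G Q₁ + varpi G Q₂ := by
  simp [varpi, add_smul, Finset.sum_add_distrib]

lemma varpi_sub (G Q₁ Q₂ : Fin M → DiffFun U) :
    varpi G (Q₁ - Q₂) = varpi G Q₁ - varpi G Q₂ := by
  simp [varpi, sub_smul]

lemma mem_adjointSymmetries_of_varpi_mem {Q : Fin M → DiffFun U} (h : varpi G Q ∈ nullForms G) :
    Q ∈ adjointSymmetries G := fun α =>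
  vanishesOn_of_mem_diffIdeal (euler_varpi G Q ▸ h α)

/-! ## The terms of Cartan's formula -/

/-- Integration by parts for `w_I = d(D_I g)`: as `d` commutes with `D_i`, each error term is the
total derivative of `f d(D_I g)`. -/
lemma smul_extD_totalDMulti_sub_mem (f g : DiffFun U) (I : MultiIdx n) :
    f • extD (totalDMulti I g) - ((-1) ^ MultiIdx.order I * totalDMulti I f) • extD g ∈
      nullForms G := by
  have := smul_sub_smul_mem_of_parts (nullForms G) (fun I => extD (totalDMulti I g))
    (fun f I i => by
      rw [totalDMulti_next, extD_totalD, ← totalDForm_smul]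
      exact totalForms_le_nullForms (totalDForm_mem_totalForms _ _)) I f
  simpa using this

/-- In `d(r D_I G) = r d(D_I G) + (D_I G) dr` the second term has coefficients in the ideal.
Multiplying the first by `H` and integrating by parts gives the coefficient `(-1)^{|I|} D_I(r H)` of
the adjoint. -/
lemma sum_smul_extD_apply_sub_mem {a : Type} [Fintype a] (R : DiffOp U a (Fin M))
    (H : a → DiffFun U) :
    ∑ i, H i • extD (R.apply G i) - varpi G (R.adjoint H) ∈ nullForms G := by
  have h₁ : ∑ i, H i • extD (R.apply G i) - varpi G (R.adjoint H) =
      ∑ i, ∑ j, (R i j).sum fun I r => H i • extD (r * totalDMulti I (G j)) -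
        ((-1) ^ MultiIdx.order I * totalDMulti I (r * H i)) • extD (G j) := by
    simp only [DiffOp.apply, DiffOp.adjoint, varpi, Finsupp.sum, map_sum, Finset.smul_sum,
      Finset.sum_smul, Finset.sum_sub_distrib]
    congr 1
    exact Finset.sum_comm
  rw [h₁]
  refine AddSubgroup.sum_mem _ fun i _ => AddSubgroup.sum_mem _ fun j _ =>
    AddSubgroup.sum_mem _ fun I _ => ?_
  have h₂ := AddSubgroup.add_mem _ (smul_extD_totalDMulti_sub_mem (G := G) (R i j I * H i) (G j) I)
    (smul_mem_nullForms (totalDMulti_mem_diffIdeal (G := G) j I) (H i • extD (R i j I)))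
  convert h₂ using 1
  beta_reduce
  rw [extD_mul, smul_add, smul_smul, mul_comm (H i), smul_comm (H i)]
  abel

/-- `d(H · R(G)) = ϖ_{R^*(H)}` up to null forms. -/
lemma extD_sum_mul_apply_sub_mem {a : Type} [Fintype a] (R : DiffOp U a (Fin M))
    (H : a → DiffFun U) :
    extD (∑ i, H i * R.apply G i) - varpi G (R.adjoint H) ∈ nullForms G := by
  have h := AddSubgroup.add_mem _ (sum_smul_extD_apply_sub_mem (G := G) R H)
    (AddSubgroup.sum_mem (nullForms G) fun i (_ : i ∈ Finset.univ) =>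
      smul_mem_nullForms (R.apply_mem_diffIdeal (G := G) i) (extD (H i)))
  convert h using 1
  simp only [map_sum, extD_mul, Finset.sum_add_distrib]
  abel

lemma hook_prolong_varpi (P : Fin m → DiffFun U) (Q : Fin M → DiffFun U) :
    hook (prolong P) (varpi G Q) = ∑ A, Q A * (frechet G).apply P A := by
  simp only [varpi, hook_sum, hook_smul, frechet_apply]

lemma hook_prolong_sourceForm (P h : Fin m → DiffFun U) :
    hook (prolong P) (sourceForm h) = ∑ α, P α * h α := by
  simp [sourceForm, hook_sum, prolong]

/-- `d(pr X_P ⌋ ω)` only depends on the Euler operator of `ω` up to null forms. -/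
lemma extD_hook_prolong_sub_mem (P : Fin m → DiffFun U) (ω : OneForm U) :
    extD (hook (prolong P) ω) - extD (∑ α, P α * euler ω α) ∈ nullForms G := by
  obtain ⟨θ, hθ⟩ := sub_sourceForm_euler_mem ω
  rw [sub_eq_iff_eq_add] at hθ
  nth_rw 1 [hθ]
  rw [hook_add, hook_prolong_sourceForm, map_add, add_sub_cancel_right, hook_sum, map_sum]
  refine AddSubgroup.sum_mem _ fun i _ => totalForms_le_nullForms ?_
  rw [hook_prolong_totalDForm, extD_totalD]
  exact totalDForm_mem_totalForms _ _

lemma lieDeriv_varpi (P : Fin m → DiffFun U) (Q : Fin M → DiffFun U) :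
    lieDeriv (prolong P) (varpi G Q) =
      varpi G ((frechet Q).apply P) + ∑ A, Q A • extD ((frechet G).apply P A) := by
  simp only [varpi, lieDeriv_sum, lieDeriv_smul, lieDeriv_extD, frechet_apply,
    Finset.sum_add_distrib]

section Operators

variable {P : Fin m → DiffFun U} {Q : Fin M → DiffFun U} {RP : DiffOp U (Fin M) (Fin M)}
  {RQ : DiffOp U (Fin m) (Fin M)}

/-- A symmetry is tangent to the system at the level of the ideal: `pr X_P` commutes with `D_I`, so
it sends the generator `D_I G^A` to `D_I` of a component of `R_P(G)`. -/
lemma hook_prolong_extD_mem_diffIdeal (hP : IsSymmetryOperator G P RP) {f : DiffFun U}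
    (hf : f ∈ diffIdeal G) : hook (prolong P) (extD f) ∈ diffIdeal G :=
  mem_diffIdeal_of_derivation (δ := fun f => hook (prolong P) (extD f))
    (fun f g => by simp only [map_add, hook_add]) (hook_extD_mul _) (fun A I => by
      rw [hook_prolong_extD_totalDMulti, ← frechet_apply, hP]
      exact totalDMulti_mem_diffIdeal_of_mem _ (RP.apply_mem_diffIdeal A)) hf

/-- Modulo total derivatives, `ϖ_Q` is the source form with coefficients `R_Q(G)` in the ideal. The
Lie derivative respects both pieces. -/
lemma lieDeriv_varpi_mem (hP : IsSymmetryOperator G P RP) (hQ : IsAdjointSymmetryOperator G Q RQ) :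
    lieDeriv (prolong P) (varpi G Q) ∈ nullForms G := by
  obtain ⟨θ, hθ⟩ := sub_sourceForm_euler_mem (varpi G Q)
  rw [sub_eq_iff_eq_add] at hθ
  rw [hθ, lieDeriv_add, lieDeriv_sum, euler_varpi, hQ, sourceForm, lieDeriv_sum]
  refine AddSubgroup.add_mem _ (AddSubgroup.sum_mem _ fun i _ => ?_)
    (AddSubgroup.sum_mem _ fun α _ => ?_)
  · rw [lieDeriv_totalDForm]
    exact totalForms_le_nullForms (totalDForm_mem_totalForms _ _)
  · have h := RQ.apply_mem_diffIdeal (G := G) α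
    rw [lieDeriv_smul]
    exact AddSubgroup.add_mem _ (smul_mem_nullForms (hook_prolong_extD_mem_diffIdeal hP h) _)
      (smul_mem_nullForms h _)

lemma lieDeriv_sub_varpi_mem (hP : IsSymmetryOperator G P RP) :
    lieDeriv (prolong P) (varpi G Q) - varpi G (actionLie P Q RP) ∈ nullForms G := by
  have h := sum_smul_extD_apply_sub_mem (G := G) RP Q
  rw [← hP] at h
  rw [lieDeriv_varpi, actionLie, varpi_add, add_sub_add_left_eq_sub]
  exact h

lemma extD_hook_sub_varpi_mem (hP : IsSymmetryOperator G P RP) :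
    extD (hook (prolong P) (varpi G Q)) - varpi G (RP.adjoint Q) ∈ nullForms G := by
  have h := extD_sum_mul_apply_sub_mem (G := G) RP Q
  rwa [← hP, ← hook_prolong_varpi] at h

/-- Here `Q · G'(P)` is replaced by `P · G'^*(Q) = P · R_Q(G)`, from which it differs by a total
derivative. -/
lemma extD_hook_sub_varpi_adjoint_mem (hQ : IsAdjointSymmetryOperator G Q RQ) :
    extD (hook (prolong P) (varpi G Q)) - varpi G (RQ.adjoint P) ∈ nullForms G := by
  have h := extD_hook_prolong_sub_mem (G := G) P (varpi G Q)
  rw [euler_varpi, hQ] at h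
  have h' := AddSubgroup.add_mem _ h (extD_sum_mul_apply_sub_mem (G := G) RQ P)
  rwa [sub_add_sub_cancel] at h'

lemma varpi_actionLie_mem (hP : IsSymmetryOperator G P RP)
    (hQ : IsAdjointSymmetryOperator G Q RQ) : varpi G (actionLie P Q RP) ∈ nullForms G := by
  have h := AddSubgroup.sub_mem _ (lieDeriv_varpi_mem hP hQ) (lieDeriv_sub_varpi_mem (Q := Q) hP)
  rwa [sub_sub_cancel] at h

lemma varpi_actionDiff_mem (hP : IsSymmetryOperator G P RP)
    (hQ : IsAdjointSymmetryOperator G Q RQ) : varpi G (actionDiff P Q RP RQ) ∈ nullForms G := by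
  rw [actionDiff, varpi_sub]
  have h := AddSubgroup.sub_mem _ (extD_hook_sub_varpi_adjoint_mem (P := P) hQ)
    (extD_hook_sub_varpi_mem (Q := Q) hP)
  rwa [sub_sub_sub_cancel_left] at h

lemma hookTwo_sub_varpi_mem (hP : IsSymmetryOperator G P RP) :
    hookTwo (prolong P) (extDForm (varpi G Q)) - varpi G ((frechet Q).apply P) ∈
      nullForms G := by
  have h := AddSubgroup.sub_mem _ (lieDeriv_sub_varpi_mem (Q := Q) hP)
    (extD_hook_sub_varpi_mem (Q := Q) hP)
  rw [lieDeriv_eq, actionLie, varpi_add] at h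
  convert h using 1
  abel

lemma hookTwo_add_varpi_mem (hP : IsSymmetryOperator G P RP)
    (hQ : IsAdjointSymmetryOperator G Q RQ) :
    hookTwo (prolong P) (extDForm (varpi G Q)) + varpi G (RQ.adjoint P) ∈ nullForms G := by
  have h := AddSubgroup.sub_mem _ (lieDeriv_varpi_mem hP hQ)
    (extD_hook_sub_varpi_adjoint_mem (P := P) hQ)
  rw [lieDeriv_eq] at h
  convert h using 1
  abel

lemma varpi_actionHook_mem (hP : IsSymmetryOperator G P RP)
    (hQ : IsAdjointSymmetryOperator G Q RQ) : varpi G (actionHook P Q RQ) ∈ nullForms G := by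
  have h := AddSubgroup.sub_mem _ (hookTwo_add_varpi_mem hP hQ)
    (hookTwo_sub_varpi_mem (Q := Q) hP)
  rw [actionHook, varpi_add]
  convert h using 1
  abel

lemma actionDiff_add_actionHook :
    actionDiff P Q RP RQ + actionHook P Q RQ = actionLie P Q RP := by
  simp only [actionDiff, actionHook, actionLie]
  abel

end Operators

/-! ## Linearity in the operators -/

/-- `R ↦ R(F)` as a linear map. -/
def DiffOp.applyLinear {a b : Type} [Fintype b] (F : b → DiffFun U) :
    DiffOp U a b →ₗ[ℝ] (a → DiffFun U) where
  toFun R := R.apply F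
  map_add' R₁ R₂ := by
    funext i
    simp only [DiffOp.apply, Pi.add_apply, ← Finset.sum_add_distrib]
    exact Finset.sum_congr rfl fun j _ =>
      Finsupp.sum_add_index' (by simp) (fun _ _ _ => add_mul _ _ _)
  map_smul' c R := by
    funext i
    simp only [DiffOp.apply, Pi.smul_apply, Finset.smul_sum, RingHom.id_apply]
    refine Finset.sum_congr rfl fun j _ => ?_
    rw [Finsupp.sum_smul_index' (by simp), Finsupp.smul_sum]
    exact Finset.sum_congr rfl fun _ _ => smul_mul_assoc _ _ _

/-- `R ↦ R^*(H)` as a linear map. -/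
def DiffOp.adjointLinear {a b : Type} [Fintype a] (H : a → DiffFun U) :
    DiffOp U a b →ₗ[ℝ] (b → DiffFun U) where
  toFun R := R.adjoint H
  map_add' R₁ R₂ := by
    funext j
    simp only [DiffOp.adjoint, Pi.add_apply, ← Finset.sum_add_distrib]
    exact Finset.sum_congr rfl fun i _ =>
      Finsupp.sum_add_index' (by simp) (fun _ _ _ => by rw [add_mul, map_add, mul_add])
  map_smul' c R := by
    funext j
    simp only [DiffOp.adjoint, Pi.smul_apply, Finset.smul_sum, RingHom.id_apply]
    refine Finset.sum_congr rfl fun i _ => ?_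
    rw [Finsupp.sum_smul_index' (by simp), Finsupp.smul_sum]
    exact Finset.sum_congr rfl fun _ _ => by beta_reduce; rw [smul_mul_assoc, map_smul, mul_smul_comm]

lemma frechet_add_apply {a : Type} (F₁ F₂ : a → DiffFun U) (P : Fin m → DiffFun U) :
    (frechet (F₁ + F₂)).apply P = (frechet F₁).apply P + (frechet F₂).apply P := by
  funext i
  simp only [Pi.add_apply, frechet_apply, map_add, hook_add]

lemma frechet_smul_apply {a : Type} (c : ℝ) (F : a → DiffFun U) (P : Fin m → DiffFun U) :
    (frechet (c • F)).apply P = c • (frechet F).apply P := by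
  funext i
  -- The real scalar is viewed as a constant differential function, so that linearity of the hook
  -- over functions applies.
  rw [Pi.smul_apply, frechet_apply, frechet_apply, Pi.smul_apply, map_smul,
    ← algebraMap_smul (DiffFun U) c (extD (F i)), hook_smul, Algebra.smul_def]

/-- A linear choice of operators `R` with `T(x) = R(G)` for a regular system. -/
lemma IsRegularSystem.exists_linear (hG : IsRegularSystem G) {a : Type} {V : Type*}
    [AddCommGroup V] [Module ℝ V] (T : V →ₗ[ℝ] (a → DiffFun U))
    (hT : ∀ x i, VanishesOn G (T x i)) :
    ∃ R : V →ₗ[ℝ] DiffOp U a (Fin M), ∀ x, T x = (R x).apply G := by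
  have hrange (x : V) : T x ∈ LinearMap.range (DiffOp.applyLinear (a := a) G) := by
    choose R hR using fun i => (hG (T x i)).1 (hT x i)
    exact ⟨fun i => R i (), funext fun i => (hR i).symm⟩
  -- Over the field `ℝ`, the surjection of `R ↦ R(G)` onto its range has a linear section; composing
  -- it with `T` makes the choice of operators linear.
  obtain ⟨s, hs⟩ := (DiffOp.applyLinear (a := a) G).rangeRestrict.exists_rightInverse_of_surjective
    (LinearMap.range_rangeRestrict _)
  refine ⟨s ∘ₗ T.codRestrict _ hrange, fun x => ?_⟩
  exact (congrArg Subtype.val (LinearMap.congr_fun hs (T.codRestrict _ hrange x))).symm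

end JetCalculus

end

open JetCalculus

theorem theorem4p4 {n m M : ℕ} (U : TopologicalSpace.Opens (Jet n m)) (G : Fin M → DiffFun U) :
    -- for regular systems the operators exist, and can be chosen linearly
    (IsRegularSystem G →
      (∃ RP : symmetries G →ₗ[ℝ] DiffOp U (Fin M) (Fin M), ∀ P : symmetries G, IsSymmetryOperator G P.1 (RP P)) ∧
      (∃ RQ : adjointSymmetries G →ₗ[ℝ] DiffOp U (Fin m) (Fin M), ∀ Q : adjointSymmetries G, IsAdjointSymmetryOperator G Q.1 (RQ Q))) ∧
    -- for every choice of the operators, the terms of the formula evaluated on the solution space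
    (∀ P ∈ symmetries G, ∀ Q ∈ adjointSymmetries G,
      ∀ (RP : DiffOp U (Fin M) (Fin M)) (RQ : DiffOp U (Fin m) (Fin M)),
      IsSymmetryOperator G P RP → IsAdjointSymmetryOperator G Q RQ →
      (lieDeriv (prolong P) (varpi G Q) =
        extD (hook (prolong P) (varpi G Q)) + hookTwo (prolong P) (extDForm (varpi G Q))) ∧
      -- the Lie derivative
      (EqOnModD G (lieDeriv (prolong P) (varpi G Q)) (varpi G (actionLie P Q RP)) ∧
        EqOnModD G (varpi G (actionLie P Q RP)) 0 ∧
        actionLie P Q RP ∈ adjointSymmetries G) ∧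
      -- the differential term
      (EqOnModD G (extD (hook (prolong P) (varpi G Q))) (varpi G (RP.adjoint Q)) ∧
        EqOnModD G (extD (hook (prolong P) (varpi G Q))) (varpi G (RQ.adjoint P)) ∧
        EqOnModD G (varpi G (actionDiff P Q RP RQ)) 0 ∧
        actionDiff P Q RP RQ ∈ adjointSymmetries G) ∧
      -- the hook term
      (EqOnModD G (hookTwo (prolong P) (extDForm (varpi G Q)))
          (varpi G ((frechet Q).apply P)) ∧
        EqOnModD G (hookTwo (prolong P) (extDForm (varpi G Q))) (-varpi G (RQ.adjoint P)) ∧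
        EqOnModD G (varpi G (actionHook P Q RQ)) 0 ∧
        actionHook P Q RQ ∈ adjointSymmetries G) ∧
      actionDiff P Q RP RQ + actionHook P Q RQ = actionLie P Q RP) ∧
    -- each of the three is an action: a bilinear map on symmetries and adjoint-symmetries
    (∀ (RP : symmetries G →ₗ[ℝ] DiffOp U (Fin M) (Fin M))
      (RQ : adjointSymmetries G →ₗ[ℝ] DiffOp U (Fin m) (Fin M)),
      (∀ P : symmetries G, IsSymmetryOperator G P.1 (RP P)) → (∀ Q : adjointSymmetries G, IsAdjointSymmetryOperator G Q.1 (RQ Q)) →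
      ∃ S S₁ S₂ : symmetries G →ₗ[ℝ] adjointSymmetries G →ₗ[ℝ] adjointSymmetries G,
        (∀ P Q, (S P Q : Fin M → DiffFun U) = actionLie P Q (RP P)) ∧
        (∀ P Q, (S₁ P Q : Fin M → DiffFun U) = actionDiff P Q (RP P) (RQ Q)) ∧
        (∀ P Q, (S₂ P Q : Fin M → DiffFun U) = actionHook P Q (RQ Q)) ∧
        S₁ + S₂ = S) := by 
  refine ⟨fun hG => ⟨?_, ?_⟩, ?_, ?_⟩
  · exact hG.exists_linear
      ({ toFun := fun P => (frechet G).apply P.1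
         map_add' := fun P₁ P₂ => DiffOp.apply_add _ _ _
         map_smul' := fun c P => DiffOp.apply_smul _ _ _ } :
        symmetries G →ₗ[ℝ] (Fin M → DiffFun U)) fun P => P.2
  · exact hG.exists_linear
      ({ toFun := fun Q => (frechet G).adjoint Q.1
         map_add' := fun P₁ P₂ => DiffOp.adjoint_add _ _ _
         map_smul' := fun c P => DiffOp.adjoint_smul _ _ _ } :
        adjointSymmetries G →ₗ[ℝ] (Fin m → DiffFun U)) fun Q => Q.2
  · intro P _ Q _ RP RQ hP hQ
    refine ⟨lieDeriv_eq _ _, ⟨?_, ?_, ?_⟩, ⟨?_, ?_, ?_, ?_⟩, ⟨?_, ?_, ?_, ?_⟩,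
      actionDiff_add_actionHook⟩
    · exact eqOnModD_of_sub_mem (lieDeriv_sub_varpi_mem hP)
    · exact eqOnModD_of_sub_mem (by simpa using varpi_actionLie_mem hP hQ)
    · exact mem_adjointSymmetries_of_varpi_mem (varpi_actionLie_mem hP hQ)
    · exact eqOnModD_of_sub_mem (extD_hook_sub_varpi_mem hP)
    · exact eqOnModD_of_sub_mem (extD_hook_sub_varpi_adjoint_mem hQ)
    · exact eqOnModD_of_sub_mem (by simpa using varpi_actionDiff_mem hP hQ)
    · exact mem_adjointSymmetries_of_varpi_mem (varpi_actionDiff_mem hP hQ)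
    · exact eqOnModD_of_sub_mem (hookTwo_sub_varpi_mem hP)
    · exact eqOnModD_of_sub_mem (by simpa using hookTwo_add_varpi_mem hP hQ)
    · exact eqOnModD_of_sub_mem (by simpa using varpi_actionHook_mem hP hQ)
    · exact mem_adjointSymmetries_of_varpi_mem (varpi_actionHook_mem hP hQ)
  · intro RP RQ hP hQ
    have hRP₁ (P P' : symmetries G) (H : Fin M → DiffFun U) : (RP (P + P')).adjoint H =
        (RP P).adjoint H + (RP P').adjoint H := by
      rw [map_add]; exact map_add (DiffOp.adjointLinear H) _ _
    have hRP₂ (c : ℝ) (P : symmetries G) (H : Fin M → DiffFun U) : (RP (c • P)).adjoint H =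
        c • (RP P).adjoint H := by
      rw [map_smul]; exact map_smul (DiffOp.adjointLinear H) _ _
    have hRQ₁ (Q Q' : adjointSymmetries G) (H : Fin m → DiffFun U) : (RQ (Q + Q')).adjoint H =
        (RQ Q).adjoint H + (RQ Q').adjoint H := by
      rw [map_add]; exact map_add (DiffOp.adjointLinear H) _ _
    have hRQ₂ (c : ℝ) (Q : adjointSymmetries G) (H : Fin m → DiffFun U) : (RQ (c • Q)).adjoint H =
        c • (RQ Q).adjoint H := by
      rw [map_smul]; exact map_smul (DiffOp.adjointLinear H) _ _
    refine ⟨LinearMap.mk₂ ℝ (fun P Q => ⟨actionLie P Q (RP P),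
        mem_adjointSymmetries_of_varpi_mem (varpi_actionLie_mem (hP P) (hQ Q))⟩) ?_ ?_ ?_ ?_,
      LinearMap.mk₂ ℝ (fun P Q => ⟨actionDiff P Q (RP P) (RQ Q),
        mem_adjointSymmetries_of_varpi_mem (varpi_actionDiff_mem (hP P) (hQ Q))⟩) ?_ ?_ ?_ ?_,
      LinearMap.mk₂ ℝ (fun P Q => ⟨actionHook P Q (RQ Q),
        mem_adjointSymmetries_of_varpi_mem (varpi_actionHook_mem (hP P) (hQ Q))⟩) ?_ ?_ ?_ ?_,
      fun _ _ => rfl, fun _ _ => rfl, fun _ _ => rfl, ?_⟩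
    rotate_right
    · ext P Q : 2
      exact Subtype.ext actionDiff_add_actionHook
    -- What remains is additivity and homogeneity in each argument: the operators depend linearly on
    -- `P` and `Q` by assumption, and the adjoint is linear both in the operator and in its
    -- argument.
    all_goals
      intros
      refine Subtype.ext ?_
      simp only [actionLie, actionDiff, actionHook, Submodule.coe_add, Submodule.coe_smul,
        DiffOp.apply_add, DiffOp.apply_smul, DiffOp.adjoint_add, DiffOp.adjoint_smul,
        frechet_add_apply, frechet_smul_apply, hRP₁, hRP₂, hRQ₁, hRQ₂]
      module
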